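/- **Notation.** For $b\in[-\tfrac12,\tfrac12]$ let $B_b$ be the Bernoulli bit with $\Pr[B_b=0]=\tfrac12+b$, $\Pr[B_b=1]=\tfrac12-b$; let $H(B_b)$ be its Shannon entropy in bits, and let $B_b^{\otimes \ell}$ denote $\ell$ independent copies. A function $f:\{0,1\}^\ell\to\{0,1\}^{m}$ is $d$-local if each of its output bits depends on at most $d$ input bits. $\Delta(D_1,D_2)=\max_T|\Pr[D_1\in T]-\Pr[D_2\in T]|$ is the total variation distance. For an even integer $N=2n-2$, consider the balanced binary tree with vertices $v_0,\dots,v_{n-1}$ in level order (root $v_0$; for $1\le i\le n-1$ the edge $e_i$ joins $v_i$ to its parent $v_{\lfloor (i-1)/2\rfloor}$). For $d\in\{0,1\}^{n-1}$ let $h(d)_i$ be the parity of the bits $d_j$ over all edges $e_j$ on the path from $v_0$ to $v_i$. For a prime $p$ and $a\in\mathbb Z$ let $\mathrm{MM}_p(a)=0$ if $a \bmod p\in\{0,\dots,p-1\}$ is less than $p/2$, and $\mathrm{MM}_p(a)=1$ otherwise. For $z=(x,d)\in\{0,1\}^{n-1}\times\{0,1\}^{n-1}$ put $$\mathrm{pmmajmod}_p(z)=\mathrm{MM}_p\Big(\sum_{i=1}^{n-1}x_i(-1)^{h(d)_i}\Big)\oplus\mathrm{parity}(x).$$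 **Theorem.** For every real $\delta<1$ there is an $\epsilon>0$ such that for all real $\alpha$ with $\alpha>0$ and $\delta/3<\alpha<1/3$ and all constants $c_1,c_2>0$ there are constants $C$ and $N_0$ such that the following holds for all even integers $N\ge N_0$, all primes $p$ with $c_1N^\alpha\le p\le c_2N^\alpha$, and all $b\in[-\tfrac12,\tfrac12]$ and real $k>0$ with $H(B_b)=1/k$. Let $f:\{0,1\}^\ell\to\{0,1\}^{N+1}$ be an $(\epsilon\log N)^{1/2}$-local function with $\ell\le kN+N^\delta$, and let $Z$ be uniform on $\{0,1\}^N$. Then $$\Delta\big(f(B_b^{\otimes\ell}),\,(Z,\mathrm{pmmajmod}_p(Z))\big)\ \ge\ \frac12-\frac{C}{\log N}.$$ -/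

import Mathlib

open MeasureTheory ProbabilityTheory
open scoped ENNReal

/-- Total variation distance of two distributions: the largest difference of the
probabilities that they give to an event. -/
noncomputable def tvDistance {Ω : Type*} [MeasurableSpace Ω] (μ ν : Measure Ω) : ℝ :=
  ⨆ T : Set Ω, |μ.real T - ν.real T|

/-- A Bernoulli bit with bias `b`: it is `0` (`false`) with probability `1/2 + b` and
`1` (`true`) with probability `1/2 - b`. -/
noncomputable def biasedBit (b : ℝ) (hb : |b| ≤ 1 / 2) : Measure Bool :=
  bernoulliMeasure false true
    ⟨1 / 2 + b, by constructor <;> linarith [(abs_le.mp hb).1, (abs_le.mp hb).2]⟩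

/-- Shannon entropy, in bits, of a distribution on `{0,1}`. -/
noncomputable def bitEntropy (μ : Measure Bool) : ℝ :=
  ∑ a : Bool, Real.negMulLog (μ.real {a}) / Real.log 2

/-- `ℓ` independent Bernoulli bits with bias `b`. -/
noncomputable def biasedBits (b : ℝ) (hb : |b| ≤ 1 / 2) (ℓ : ℕ) : Measure (Fin ℓ → Bool) :=
  Measure.pi fun _ => biasedBit b hb

/-- `f` is `d`-local: each output bit depends on at most `d` input bits. -/
def IsLocal {ℓ m : ℕ} (d : ℝ) (f : (Fin ℓ → Bool) → (Fin m → Bool)) : Prop :=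
  ∀ i : Fin m, ∃ S : Finset (Fin ℓ), (S.card : ℝ) ≤ d ∧ DependsOn (fun u => f u i) (S : Set (Fin ℓ))

/-- The balanced binary tree with vertices `v_0, v_1, …` in level order: `v_0` is the root, and for
`i ≥ 1` the edge `e_i` joins `v_i` to its parent `v_⌊(i-1)/2⌋`. `pathEdges i` is the set of the
indices of the edges on the path from the root to `v_i`. -/
def pathEdges : ℕ → Finset ℕ
  | 0 => ∅
  | i + 1 => insert (i + 1) (pathEdges (i / 2))
decreasing_by exact Nat.lt_succ_of_le (Nat.div_le_self i 2)

/-- The parity of the edge values on the path from the root to each non-root vertex, in the balanced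
binary tree on `m + 1` vertices. The index `i : Fin m` stands for the vertex `v_{i+1}`, and
likewise for the edge `e_{i+1}`. -/
def pathParity {m : ℕ} (d : Fin m → Bool) (i : Fin m) : Bool :=
  decide (Odd (Finset.univ.filter fun j : Fin m =>
    (j : ℕ) + 1 ∈ pathEdges ((i : ℕ) + 1) ∧ d j = true).card)

/-- The parity of a bit string. -/
def bitParity {m : ℕ} (x : Fin m → Bool) : Bool :=
  decide (Odd (Finset.univ.filter fun i => x i = true).card)

/-- `0` if the residue of `a` in `{0, …, p-1}` is less than `p/2`, and `1` otherwise. -/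
def majMod (p : ℕ) (a : ℤ) : Bool :=
  decide ((p : ℚ) / 2 ≤ ((a % (p : ℤ) : ℤ) : ℚ))

/-- The signed sum `∑ x_i (-1)^{h(d)_i}` over the non-root vertices. -/
def signedSum {m : ℕ} (x d : Fin m → Bool) : ℤ :=
  ∑ i, if x i then (if pathParity d i then -1 else 1) else 0

/-- The function pmmajmod on strings of even length `N = 2m`: the first `m` bits are the
vertex bits `x`, the next `m` bits are the edge bits `d`. -/
def pmMajMod (p : ℕ) {N : ℕ} (z : Fin N → Bool) : Bool :=
  let x : Fin (N / 2) → Bool := fun i => z ⟨i, by omega⟩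
  let d : Fin (N / 2) → Bool := fun i => z ⟨N / 2 + i, by omega⟩
  xor (majMod p (signedSum x d)) (bitParity x)

/-- The distribution of `(Z, pmmajmod_p(Z))` on `N + 1` bits, for `Z` uniform on `{0,1}^N`. -/
noncomputable def targetDist (p N : ℕ) : Measure (Fin (N + 1) → Bool) :=
  (PMF.uniformOfFintype (Fin N → Bool)).toMeasure.map
    fun z => (Fin.snoc z (pmMajMod p z) : Fin (N + 1) → Bool)

/-!
The distance is bounded by one statistical test, built from the dependencies of the sampler `f`.

*Isolated inputs.* Cutting the tree at a suitable level leaves few vertices above the cut and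
subtrees of size `O(D)` below it, where `D` is the locality. Discarding the inputs that influence
many vertices, anything above the cut, or the last output bit, a greedy choice finds a set `A` of
`N / polylog N` inputs that act on disjoint unions `V a` of such subtrees, of size `O(D ^ 2)`
(`exists_isolated`). Once the inputs outside `A` are fixed, the signed sum is a constant plus
independent summands, one for each `a ∈ A` and depending on `a` only, and the last output bit is
fixed. An input in `A` is called inert if it influences no output, and active if it changes the signed
sum.

*The test.* It accepts a string in any of the following events, all of which are unlikely for
the target.

* The string is `heavy`: `f` outputs it with probability at least `2 ^ (-N)` times a large factor.
  There are too few such strings (`targetDist_heavy_le`). If many inputs are inert, then the other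
  inputs carry less than `N` bits of information, up to a deviation that Chebyshev's inequality
  controls, and they determine the output; so the output is heavy (`expect_notMem_heavy_le`).
* Few of the sets `V a` show the extremal pattern, with all vertex bits set and all path parities even
  (`fewPatterns`). In terms of vertex bits and path parities the target is uniform, so each pattern
  has probability `4 ^ (-|V a|) ≥ N ^ (-γ / 2)` and they are independent; here the locality
  `√(ε log N)` is used. The extremal pattern is the only one that maximizes the summand of `V a`, so
  an isolated input whose `V a` shows it is inert or active (`mem_activeInputs`). Hence with few inert
  and few active inputs the test accepts.
* The last bit is wrong (`wrongLast`), which has probability zero for the target. If many inputs are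
  active, then the signed sum is almost equidistributed modulo `p` even jointly with its parity, which
  is the parity of the vertex bits: the characters modulo `p`, twisted by the sign of the parity, are
  products of many factors bounded away from `1` by order of `p ^ (-2)`
  (`norm_avg_signedPhase_le`, `norm_expect_bitSign_le`), and `p ^ 2` is at most of order
  `N ^ (2 / 3)`. So the fixed last bit is wrong with probability close to `1 / 2`.

Whatever the inputs outside `A`, the test thus accepts the output of `f` with probability almost `1 / 2`
(`le_tvDistance_of_isolated`). A sampler with fewer than `N` input bits is treated separately, by
the size of its range (`half_le_tvDistance_of_lt`).
-/

namespace LocalSampling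

/-! ### Expectations over independent bits -/

section Expectation

variable {ι : Type*} [Fintype ι]

/-- The probability of the bit string `u` when its bits are independent and each of them takes the
value `c` with probability `w c`. -/
noncomputable def prodWeight (w : Bool → ℝ) (u : ι → Bool) : ℝ := ∏ i, w (u i)

lemma prodWeight_nonneg {w : Bool → ℝ} (hw : ∀ c, 0 ≤ w c) (u : ι → Bool) :
    0 ≤ prodWeight w u := Finset.prod_nonneg fun _ _ => hw _

variable [DecidableEq ι] {E : Type*} [AddCommGroup E] [Module ℝ E]

/-- The expectation of `g` over independent bits of law `w`. -/
noncomputable def expect (w : Bool → ℝ) (g : (ι → Bool) → E) : E := ∑ u, prodWeight w u • g u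

/-- The probability that the bits in `R` take prescribed values. -/
lemma expect_cylinder {w : Bool → ℝ} (hw : w true + w false = 1) (R : Finset ι) (u : ι → Bool) :
    expect w (fun v => if ∀ i ∈ R, v i = u i then (1 : ℝ) else 0) = ∏ i ∈ R, w (u i) := by
  have h1 : ∀ v : ι → Bool, prodWeight w v • (if ∀ i ∈ R, v i = u i then (1 : ℝ) else 0) =
      ∏ i, (if i ∈ R then (if v i = u i then w (v i) else 0) else w (v i)) := by
    intro v
    unfold prodWeight
    split_ifs with h
    · rw [smul_eq_mul, mul_one]
      refine Finset.prod_congr rfl fun i _ => ?_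
      by_cases hi : i ∈ R <;> simp [hi, h]
    · push Not at h
      obtain ⟨i, hi, hne⟩ := h
      rw [smul_zero, eq_comm]
      exact Finset.prod_eq_zero (Finset.mem_univ i) (by simp [hi, hne])
  unfold expect
  simp_rw [h1]
  have h2 := Finset.prod_univ_sum (fun _ : ι => (Finset.univ : Finset Bool))
    (fun i c => if i ∈ R then (if c = u i then w c else 0) else w c)
  rw [Fintype.piFinset_univ] at h2
  rw [← h2, ← Finset.prod_filter_mul_prod_filter_not Finset.univ (· ∈ R)]
  rw [Finset.prod_eq_one (s := Finset.univ.filter (· ∉ R)), mul_one]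
  · rw [Finset.filter_mem_eq_inter, Finset.univ_inter]
    refine Finset.prod_congr rfl fun i hi => ?_
    simp [hi]
  · intro i hi
    simp only [Finset.mem_filter, Finset.mem_univ, true_and] at hi
    rw [Fintype.sum_bool, if_neg hi, if_neg hi]
    exact hw

lemma sum_prodWeight {w : Bool → ℝ} (hw : w true + w false = 1) :
    ∑ u : ι → Bool, prodWeight w u = 1 := by
  have := expect_cylinder hw (∅ : Finset ι) (fun _ => true)
  simpa [expect] using this

/-- Resampling one coordinate does not change an expectation. -/
lemma expect_resample {w : Bool → ℝ} (hw : w true + w false = 1) (i : ι) (g : (ι → Bool) → E) :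
    expect w g = expect w fun u => ∑ c, w c • g (Function.update u i c) := by
  have hwt : ∀ (u : ι → Bool) (c : Bool),
      prodWeight w u * w c = prodWeight w (Function.update u i c) * w (u i) := by
    intro u c
    unfold prodWeight
    rw [← Finset.mul_prod_erase _ _ (Finset.mem_univ i),
      ← Finset.mul_prod_erase _ (fun j => w (Function.update u i c j)) (Finset.mem_univ i)]
    have : ∏ x ∈ Finset.univ.erase i, w (Function.update u i c x) =
        ∏ x ∈ Finset.univ.erase i, w (u x) :=
      Finset.prod_congr rfl fun j hj => by
        rw [Function.update_of_ne (Finset.ne_of_mem_erase hj)]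
    rw [this, Function.update_self]
    ring
  unfold expect
  have hsum : ∑ u : ι → Bool, prodWeight w u • ∑ c, w c • g (Function.update u i c) =
      ∑ u : ι → Bool, ∑ c,
        (prodWeight w (Function.update u i c) * w (u i)) • g (Function.update u i c) :=
    Finset.sum_congr rfl fun u _ => by
      rw [Finset.smul_sum]
      exact Finset.sum_congr rfl fun c _ => by rw [smul_smul, hwt]
  rw [hsum, ← Fintype.sum_prod_type'
    (f := fun u c => (prodWeight w (Function.update u i c) * w (u i)) • g (Function.update u i c))]
  -- The old and the new value of the coordinate are exchanged.
  have hinv : Function.Involutive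
      fun q : (ι → Bool) × Bool => (Function.update q.1 i q.2, q.1 i) := by
    rintro ⟨u, c⟩
    simp
  rw [← Equiv.sum_comp hinv.toPerm]
  simp only [Function.Involutive.coe_toPerm, Function.update_idem, Function.update_self,
    Function.update_eq_self]
  rw [Fintype.sum_prod_type' (f := fun u c => (prodWeight w u * w c) • g u)]
  refine Finset.sum_congr rfl fun u _ => ?_
  rw [← Finset.sum_smul, ← Finset.mul_sum]
  simp [hw]

lemma expect_mul_eq_zero {w : Bool → ℝ} (hw : w true + w false = 1) (i : ι) {ξ : Bool → ℝ}
    (hξ : ∑ c, w c * ξ c = 0) {g : (ι → Bool) → ℝ}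
    (hg : ∀ u c, g (Function.update u i c) = g u) :
    expect w (fun u => ξ (u i) * g u) = 0 := by
  rw [expect_resample hw i]
  have : (fun u : ι → Bool => ∑ c, w c • (ξ (Function.update u i c i) * g (Function.update u i c)))
      = fun _ => (0 : ℝ) := by
    funext u
    simp only [Function.update_self, hg, smul_eq_mul, ← mul_assoc]
    rw [← Finset.sum_mul, hξ, zero_mul]
  rw [this]
  simp [expect]

/-- If `φ a` depends on no coordinate in `A` but `a`, and `G` on none, then the coordinates in `A`
can be averaged out separately. -/
lemma expect_prod_resample {w : Bool → ℝ} (hw : w true + w false = 1) (A : Finset ι)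
    (G : (ι → Bool) → ℂ) (φ : ι → (ι → Bool) → ℂ)
    (hG : ∀ a ∈ A, ∀ u c, G (Function.update u a c) = G u)
    (hφ : ∀ a ∈ A, ∀ b ∈ A, b ≠ a → ∀ u c, φ a (Function.update u b c) = φ a u) :
    expect w (fun u => G u * ∏ a ∈ A, φ a u) =
      expect w (fun u => G u * ∏ a ∈ A, ∑ c, w c • φ a (Function.update u a c)) := by
  induction A using Finset.induction_on generalizing G with
  | empty => rfl
  | insert a A ha ih =>
    have hne : ∀ b ∈ A, b ≠ a := fun b hb h => ha (h ▸ hb)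
    simp_rw [Finset.prod_insert ha, ← mul_assoc]
    rw [← ih (fun u => G u * ∑ c, w c • φ a (Function.update u a c)),
      expect_resample hw a]
    · congr 1
      funext u
      simp_rw [hG a (Finset.mem_insert_self a A)]
      have : ∀ c, ∏ x ∈ A, φ x (Function.update u a c) = ∏ x ∈ A, φ x u := fun c =>
        Finset.prod_congr rfl fun b hb =>
          hφ b (Finset.mem_insert_of_mem hb) a (Finset.mem_insert_self a A) (hne b hb).symm u c
      simp_rw [this]
      rw [Finset.mul_sum, Finset.sum_mul]
      refine Finset.sum_congr rfl fun c _ => ?_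
      simp only [Complex.real_smul]
      ring
    · intro b hb u c
      rw [hG b (Finset.mem_insert_of_mem hb)]
      congr 1
      refine Finset.sum_congr rfl fun c' _ => ?_
      rw [Function.update_comm (hne b hb),
        hφ a (Finset.mem_insert_self a A) b (Finset.mem_insert_of_mem hb) (hne b hb)]
    · intro b hb b' hb' h u c
      exact hφ b (Finset.mem_insert_of_mem hb) b' (Finset.mem_insert_of_mem hb') h u c

lemma expect_mono {w : Bool → ℝ} (hw : ∀ c, 0 ≤ w c) {g h : (ι → Bool) → ℝ}
    (hgh : ∀ u, g u ≤ h u) : expect w g ≤ expect w h :=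
  Finset.sum_le_sum fun u _ => mul_le_mul_of_nonneg_left (hgh u) (prodWeight_nonneg hw u)

lemma expect_const {w : Bool → ℝ} (hw : w true + w false = 1) (c : ℝ) :
    expect w (fun _ : ι → Bool => c) = c := by
  unfold expect
  rw [← Finset.sum_smul, sum_prodWeight hw, one_smul]

lemma expect_sum {w : Bool → ℝ} {κ : Type*} (s : Finset κ) (g : κ → (ι → Bool) → E) :
    expect w (fun u => ∑ k ∈ s, g k u) = ∑ k ∈ s, expect w (g k) := by
  unfold expect
  simp_rw [Finset.smul_sum]
  exact Finset.sum_comm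

lemma expect_mul_left {w : Bool → ℝ} (c : ℝ) (g : (ι → Bool) → ℝ) :
    expect w (fun u => c * g u) = c * expect w g := by
  unfold expect
  rw [Finset.mul_sum]
  exact Finset.sum_congr rfl fun u _ => by simp only [smul_eq_mul]; ring

lemma expect_add {w : Bool → ℝ} (g h : (ι → Bool) → E) :
    expect w (fun u => g u + h u) = expect w g + expect w h := by
  simp [expect, smul_add, Finset.sum_add_distrib]

lemma expect_sub {w : Bool → ℝ} (g h : (ι → Bool) → E) :
    expect w (fun u => g u - h u) = expect w g - expect w h := by
  simp [expect, smul_sub, Finset.sum_sub_distrib]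

/-- Chebyshev's inequality. -/
lemma expect_indicator_le {w : Bool → ℝ} (hw : ∀ c, 0 ≤ w c) {Z : (ι → Bool) → ℝ} {s V : ℝ}
    (hs : 0 < s) (hV : expect w (fun u => Z u ^ 2) ≤ V) (P : (ι → Bool) → Prop) [DecidablePred P]
    (hP : ∀ u, P u → s ≤ |Z u|) :
    expect w (fun u => if P u then (1 : ℝ) else 0) ≤ V / s ^ 2 := by
  rw [le_div_iff₀ (by positivity)]
  refine le_trans ?_ hV
  rw [mul_comm, ← expect_mul_left]
  refine expect_mono hw fun u => ?_
  split_ifs with h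
  · rw [mul_one, ← sq_abs (Z u)]
    exact pow_le_pow_left₀ hs.le (hP u h) 2
  · rw [mul_zero]
    positivity

/-- A sum of centred terms `ξ (u i)` over a random set `R u` of coordinates behaves, in second
moment, like one over a fixed set if membership in `R u` is decided by the coordinates outside `A`
and these all belong to `R u`: of two different coordinates, one is then independent of the
other and of both membership events. -/
lemma expect_sq_sum_le {w : Bool → ℝ} (hw0 : ∀ c, 0 ≤ w c) (hw : w true + w false = 1)
    {ξ : Bool → ℝ} (hξ : ∑ c, w c * ξ c = 0) {V : ℝ} (hV : ∑ c, w c * ξ c ^ 2 ≤ V)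
    (A W : Finset ι) (R : (ι → Bool) → Finset ι) (hR : ∀ a ∈ A, ∀ u c, R (Function.update u a c) = R u)
    (hA : ∀ u, ∀ i ∉ A, i ∈ R u) (hW : ∀ u, R u ⊆ W) :
    expect w (fun u => (∑ i ∈ R u, ξ (u i)) ^ 2) ≤ W.card * V := by
  have h0 : ∀ u, (∑ i ∈ R u, ξ (u i)) ^ 2 =
      ∑ i ∈ W, ∑ j ∈ W, (if i ∈ R u then ξ (u i) else 0) * (if j ∈ R u then ξ (u j) else 0) := by
    intro u
    rw [← Finset.sum_mul_sum, ← sq]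
    congr 1
    rw [← Finset.sum_filter]
    congr 1
    ext i
    simp only [Finset.mem_filter]
    exact ⟨fun h => ⟨hW u h, h⟩, fun h => h.2⟩
  simp_rw [h0]
  rw [expect_sum]
  rw [← nsmul_eq_mul]
  refine Finset.sum_le_card_nsmul _ _ _ fun i hi => ?_
  rw [expect_sum, Finset.sum_eq_single_of_mem i hi]
  · refine le_trans (expect_mono hw0 (h := fun u => ξ (u i) ^ 2) fun u => ?_) ?_
    · split_ifs
      · rw [sq]
      · simp only [mul_zero]; positivity
    · rw [expect_resample hw i]
      simp only [Function.update_self, smul_eq_mul]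
      rw [expect_const hw]
      exact hV
  · have key : ∀ i j : ι, i ≠ j → (i ∈ A ∨ j ∉ A) →
        expect w (fun u => (if i ∈ R u then ξ (u i) else 0) * (if j ∈ R u then ξ (u j) else 0)) = 0 := by
      intro i j hij hc
      have : ∀ u, (if i ∈ R u then ξ (u i) else 0) * (if j ∈ R u then ξ (u j) else 0) =
          ξ (u i) * ((if i ∈ R u then 1 else 0) * (if j ∈ R u then ξ (u j) else 0)) := by
        intro u; split_ifs <;> simp
      simp_rw [this]
      refine expect_mul_eq_zero hw i hξ fun u c => ?_
      rw [Function.update_of_ne hij.symm]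
      by_cases hi : i ∈ A
      · rw [hR i hi]
      · have hj := hc.resolve_left hi
        simp [hA _ i hi, hA _ j hj]
    intro j hj hji
    by_cases hi : i ∈ A
    · exact key i j hji.symm (Or.inl hi)
    · simp_rw [mul_comm (if i ∈ R _ then ξ _ else 0)]
      exact key j i hji (Or.inr hi)

/-- Disjoint patterns of probability at least `ρ` each: the number of those that occur in a
string of independent bits is rarely below half of its expectation. -/
lemma expect_few_patterns_le {w : Bool → ℝ} (hw0 : ∀ c, 0 ≤ w c) (hw : w true + w false = 1)
    {κ : Type*} [DecidableEq κ] (A : Finset κ) (S : κ → Finset ι)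
    (hS : ∀ a ∈ A, ∀ b ∈ A, a ≠ b → Disjoint (S a) (S b)) (t : ι → Bool) {ρ : ℝ} (hρ : 0 < ρ)
    (hA : A.Nonempty) (hSρ : ∀ a ∈ A, ρ ≤ ∏ i ∈ S a, w (t i)) :
    expect w (fun u => if ((A.filter fun a => ∀ i ∈ S a, u i = t i).card : ℝ) < A.card * ρ / 2
      then (1 : ℝ) else 0) ≤ 4 / (A.card * ρ) := by
  set q : κ → ℝ := fun a => ∏ i ∈ S a, w (t i) with hq
  set M : ℝ := ∑ a ∈ A, q a with hM
  have hAc : (0 : ℝ) < A.card := by exact_mod_cast hA.card_pos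
  have hMρ : A.card * ρ ≤ M := by
    rw [← nsmul_eq_mul]
    exact Finset.card_nsmul_le_sum _ _ _ hSρ
  have hM0 : 0 < M := lt_of_lt_of_le (by positivity) hMρ
  have hq0 : ∀ a, 0 ≤ q a := fun a => Finset.prod_nonneg fun _ _ => hw0 _
  set X : κ → (ι → Bool) → ℝ := fun a u => if ∀ i ∈ S a, u i = t i then 1 else 0 with hX
  have hcard : ∀ u, ((A.filter fun a => ∀ i ∈ S a, u i = t i).card : ℝ) = ∑ a ∈ A, X a u := by
    intro u
    rw [Finset.card_filter]
    push_cast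
    rfl
  have hE : expect w (fun u => ∑ a ∈ A, X a u) = M := by
    rw [expect_sum]
    exact Finset.sum_congr rfl fun a _ => expect_cylinder hw (S a) t
  have hE2 : expect w (fun u => (∑ a ∈ A, X a u) ^ 2) ≤ M ^ 2 + M := by
    simp_rw [sq, Finset.sum_mul_sum, expect_sum]
    rw [hM, Finset.sum_mul_sum, ← Finset.sum_add_distrib]
    refine Finset.sum_le_sum fun a ha => ?_
    rw [← Finset.add_sum_erase _ _ ha, ← Finset.add_sum_erase A (fun b => q a * q b) ha]
    have h1 : expect w (fun u => X a u * X a u) = q a := by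
      refine Eq.trans ?_ (expect_cylinder hw (S a) t)
      congr 1
      funext u
      simp only [hX]
      split_ifs <;> simp
    have h2 : ∑ b ∈ A.erase a, expect w (fun u => X a u * X b u) =
        ∑ b ∈ A.erase a, q a * q b := by
      refine Finset.sum_congr rfl fun b hb => ?_
      have hab : a ≠ b := (Finset.ne_of_mem_erase hb).symm
      have hab' : q a * q b = ∏ i ∈ S a ∪ S b, w (t i) :=
        (Finset.prod_union (hS a ha b (Finset.mem_of_mem_erase hb) hab)).symm
      rw [hab', ← expect_cylinder hw (S a ∪ S b) t]
      congr 1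
      funext u
      simp only [hX, Finset.mem_union, or_imp, forall_and, ite_and, mul_ite, mul_one, mul_zero]
      split_ifs <;> rfl
    rw [h1, h2]
    nlinarith [hq0 a]
  have hvar : expect w (fun u => (∑ a ∈ A, X a u - M) ^ 2) ≤ M := by
    have : (fun u => (∑ a ∈ A, X a u - M) ^ 2) = fun u =>
        ((∑ a ∈ A, X a u) ^ 2 - (2 * M) * (∑ a ∈ A, X a u)) + M ^ 2 := by
      funext u; ring
    rw [this, expect_add, expect_sub, expect_mul_left, hE, expect_const hw]
    nlinarith
  refine le_trans (expect_indicator_le hw0 (s := M / 2) (by positivity) hvar _ ?_) ?_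
  · intro u hu
    rw [hcard] at hu
    rw [le_abs]
    right
    linarith
  · have : M / (M / 2) ^ 2 = 4 / M := by field_simp; norm_num
    rw [this]
    gcongr

end Expectation

/-! ### The balanced binary tree -/

section Tree

/-- With heap numbering, in which `v_i` has number `i + 1` and the parent of `g` is `g / 2`, the
edges above a vertex belong to its iterated halves. -/
lemma exists_div_pow_of_mem_pathEdges {j v : ℕ} (h : j ∈ pathEdges v) :
    ∃ s, (v + 1) / 2 ^ s = j + 1 := by
  induction v using Nat.strong_induction_on with
  | _ v ih =>
    cases v with
    | zero => simp [pathEdges] at h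
    | succ i =>
      rw [pathEdges, Finset.mem_insert] at h
      rcases h with rfl | h
      · exact ⟨0, by simp⟩
      · obtain ⟨s, hs⟩ := ih (i / 2) (by omega) h
        refine ⟨s + 1, ?_⟩
        rw [← hs, pow_succ', ← Nat.div_div_eq_div_mul]
        congr 1
        omega

lemma self_mem_pathEdges (v : ℕ) : v + 1 ∈ pathEdges (v + 1) := by
  rw [pathEdges]
  exact Finset.mem_insert_self _ _

lemma le_of_mem_pathEdges {j v : ℕ} (h : j ∈ pathEdges v) : j ≤ v := by
  obtain ⟨s, hs⟩ := exists_div_pow_of_mem_pathEdges h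
  have := Nat.div_le_self (v + 1) (2 ^ s)
  omega

variable {m : ℕ}

lemma pathParity_congr {d d' : Fin m → Bool} {i : Fin m}
    (h : ∀ j : Fin m, (j : ℕ) + 1 ∈ pathEdges ((i : ℕ) + 1) → d j = d' j) :
    pathParity d i = pathParity d' i := by
  unfold pathParity
  congr 3
  refine Finset.filter_congr fun j _ => and_congr_right fun hj => ?_
  rw [h j hj]

lemma eq_of_pathParity_eq {d d' : Fin m → Bool} {i : Fin m}
    (h : ∀ j : Fin m, j ≠ i → (j : ℕ) + 1 ∈ pathEdges ((i : ℕ) + 1) → d j = d' j)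
    (hi : pathParity d i = pathParity d' i) : d i = d' i := by
  have key : ∀ e : Fin m → Bool, pathParity e i =
      xor (e i) (pathParity (Function.update e i false) i) := by
    intro e
    unfold pathParity
    set S := Finset.univ.filter fun j : Fin m =>
      (j : ℕ) + 1 ∈ pathEdges ((i : ℕ) + 1) ∧ Function.update e i false j = true with hS
    have hiS : i ∉ S := by simp [hS]
    cases hei : e i with
    | false =>
      rw [Bool.false_xor, hS, ← hei, Function.update_eq_self]
    | true =>
      have : (Finset.univ.filter fun j : Fin m =>
          (j : ℕ) + 1 ∈ pathEdges ((i : ℕ) + 1) ∧ e j = true) = insert i S := by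
        ext j
        by_cases hj : j = i
        · subst hj
          simp [hei, self_mem_pathEdges]
        · simp [hS, hj]
      rw [this, Finset.card_insert_of_notMem hiS]
      simp only [Nat.odd_add_one, decide_not, Bool.true_xor]
  have h2 : pathParity (Function.update d i false) i = pathParity (Function.update d' i false) i := by
    refine pathParity_congr fun j hj => ?_
    by_cases hji : j = i
    · subst hji; simp
    · simp [hji, h j hji hj]
  rw [key d, key d', h2] at hi
  exact Bool.xor_left_inj.mp hi

/-- Path parities determine the edge bits, locally: on a set `V` that is closed under passing to
edges of the path to the root, up to edges in `T`, where the edge bits are known. -/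
lemma eqOn_of_pathParity_eqOn {d d' : Fin m → Bool} {T V : Set (Fin m)}
    (hT : ∀ j ∈ T, d j = d' j)
    (hV : ∀ i ∈ V, ∀ j : Fin m, (j : ℕ) + 1 ∈ pathEdges ((i : ℕ) + 1) → j ∈ T ∨ j ∈ V)
    (h : ∀ i ∈ V, pathParity d i = pathParity d' i) : ∀ i ∈ V, d i = d' i := by
  intro i
  induction i using WellFoundedLT.induction with
  | ind i ih =>
    intro hi
    refine eq_of_pathParity_eq (fun j hji hj => ?_) (h i hi)
    rcases hV i hi j hj with hj' | hj'
    · exact hT j hj'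
    · have := le_of_mem_pathEdges hj
      exact ih j (lt_of_le_of_ne (Fin.le_def.mpr (by omega)) hji) hj'

lemma pathParity_injective : Function.Injective (pathParity : (Fin m → Bool) → Fin m → Bool) := by
  intro d d' h
  funext i
  exact eqOn_of_pathParity_eqOn (T := ∅) (V := Set.univ) (by simp) (by simp)
    (fun i _ => congrFun h i) i trivial

/-- The tree is cut at a level: above it there are few vertices, and below it the tree falls into
small subtrees, labelled by `unit`, such that a path to the root leaves the subtree of its
starting point only to edges above the cut. -/
lemma exists_cut {J : ℕ} (hJ : 2 ^ J ≤ m + 1) :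
    ∃ (top : Finset (Fin m)) (unit : Fin m → ℕ), top.card * 2 ^ J ≤ m + 1 ∧
      (∀ t, (Finset.univ.filter fun i => i ∉ top ∧ unit i = t).card ≤ 2 ^ (J + 1)) ∧
      ∀ i j : Fin m, (j : ℕ) + 1 ∈ pathEdges ((i : ℕ) + 1) →
        j ∈ top ∨ (i ∉ top ∧ unit j = unit i) := by
  set K := Nat.log 2 (m + 1) with hK
  have hJK : J ≤ K := Nat.le_log_of_pow_le (by norm_num) hJ
  set L := K - J with hL
  refine ⟨Finset.univ.filter fun i : Fin m => (i : ℕ) + 2 < 2 ^ L,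
    fun i => ((i : ℕ) + 2) / 2 ^ (Nat.log 2 ((i : ℕ) + 2) - L), ?_, ?_, ?_⟩
  · have h1 : (Finset.univ.filter fun i : Fin m => (i : ℕ) + 2 < 2 ^ L).card ≤ 2 ^ L := by
      rw [← Finset.card_map Fin.valEmbedding]
      refine (Finset.card_le_card (t := Finset.range (2 ^ L)) ?_).trans (by simp)
      intro x hx
      simp only [Finset.mem_map, Finset.mem_filter, Finset.mem_univ, true_and] at hx
      obtain ⟨i, hi, rfl⟩ := hx
      simp only [Fin.valEmbedding_apply, Finset.mem_range]
      omega
    calc _ ≤ 2 ^ L * 2 ^ J := Nat.mul_le_mul_right _ h1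
      _ = 2 ^ K := by rw [← pow_add]; congr 1; omega
      _ ≤ m + 1 := Nat.pow_log_le_self 2 (by omega)
  · intro t
    set e : Fin m ↪ ℕ := ⟨fun i => (i : ℕ) + 2, fun i j h => Fin.ext (by simpa using h)⟩ with he
    rw [← Finset.card_map e]
    have hsub : (Finset.univ.filter fun i : Fin m =>
        i ∉ (Finset.univ.filter fun i : Fin m => (i : ℕ) + 2 < 2 ^ L) ∧
          ((i : ℕ) + 2) / 2 ^ (Nat.log 2 ((i : ℕ) + 2) - L) = t).map e ⊆
        (Finset.range (J + 1)).biUnion fun s => Finset.Ico (t * 2 ^ s) ((t + 1) * 2 ^ s) := by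
      intro g hg
      simp only [Finset.mem_map, Finset.mem_filter, Finset.mem_univ, true_and] at hg
      obtain ⟨i, ⟨-, ht⟩, rfl⟩ := hg
      have hi := i.isLt
      change (i : ℕ) + 2 ∈ _
      simp only [Finset.mem_biUnion, Finset.mem_range, Finset.mem_Ico]
      have hlog : Nat.log 2 ((i : ℕ) + 2) ≤ K := Nat.log_mono_right (by omega)
      refine ⟨Nat.log 2 ((i : ℕ) + 2) - L, by omega, ?_⟩
      rw [Nat.div_eq_iff (by positivity)] at ht
      refine ⟨by omega, ?_⟩
      have : 0 < 2 ^ (Nat.log 2 ((i : ℕ) + 2) - L) := by positivity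
      rw [add_mul, one_mul]
      omega
    refine (Finset.card_le_card hsub).trans (Finset.card_biUnion_le.trans ?_)
    have : ∀ s, (Finset.Ico (t * 2 ^ s) ((t + 1) * 2 ^ s)).card = 2 ^ s := by
      intro s
      rw [Nat.card_Ico, add_mul, one_mul, Nat.add_sub_cancel_left]
    simp_rw [this]
    rw [Nat.geomSum_eq le_rfl]
    simp
  · intro i j hj
    by_cases hjt : (j : ℕ) + 2 < 2 ^ L
    · exact Or.inl (by simpa using hjt)
    right
    have hle := le_of_mem_pathEdges hj
    refine ⟨by simp only [Finset.mem_filter, Finset.mem_univ, true_and]; omega, ?_⟩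
    obtain ⟨s, hs⟩ := exists_div_pow_of_mem_pathEdges hj
    have hs' : ((i : ℕ) + 2) / 2 ^ s = (j : ℕ) + 2 := hs
    have hLj : L ≤ Nat.log 2 ((j : ℕ) + 2) := Nat.le_log_of_pow_le (by norm_num) (by omega)
    have hlog : Nat.log 2 ((j : ℕ) + 2) = Nat.log 2 ((i : ℕ) + 2) - s := by
      rw [← hs', Nat.log_div_base_pow]
    dsimp only
    rw [← hs', Nat.div_div_eq_div_mul, ← pow_add]
    congr 2
    rw [hs', hlog]
    by_cases hsi : s ≤ Nat.log 2 ((i : ℕ) + 2)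
    · omega
    · -- Otherwise the quotient would vanish.
      exfalso
      have : ((i : ℕ) + 2) / 2 ^ s = 0 := Nat.div_eq_of_lt (Nat.lt_pow_of_log_lt (by norm_num) (by omega))
      omega

end Tree

/-! ### Inputs with separate spheres of influence -/

section Isolated

variable {ι : Type*} {m : ℕ}

/-- The input bits in `A` act on separate parts of the tree: no edge or vertex in `top`, nor the
extra output, depends on them (`Wv i` and `Wl` are the inputs on which vertex `i` with its edge,
and the extra output, may depend); those that depend on `a` lie in `V a`; the sets `V a` are
disjoint, and the path from a vertex to the root does not cross the boundary of `V a` outside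
`top`. -/
structure Isolated (Wv : Fin m → Finset ι) (Wl : Finset ι) (top : Finset (Fin m))
    (V : ι → Finset (Fin m)) (A : Finset ι) : Prop where
  notMem_last : ∀ a ∈ A, a ∉ Wl
  notMem_of_top : ∀ a ∈ A, ∀ i ∈ top, a ∉ Wv i
  mem : ∀ a ∈ A, ∀ i, a ∈ Wv i → i ∈ V a
  disj : ∀ a ∈ A, ∀ b ∈ A, a ≠ b → Disjoint (V a) (V b)
  path : ∀ a ∈ A, ∀ i j : Fin m, (j : ℕ) + 1 ∈ pathEdges ((i : ℕ) + 1) →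
    j ∈ top ∨ (i ∈ V a ↔ j ∈ V a)

/-- Isolated inputs exist in number `m / O(D ^ 3)`: the sets `V a` consist of whole subtrees below
a cut of the tree, and `A` is a maximal disjoint choice among the inputs that influence few
vertices and nothing above the cut. -/
lemma exists_isolated [Fintype ι] [DecidableEq ι] (Wv : Fin m → Finset ι) (Wl : Finset ι) {D J : ℕ}
    (hWv : ∀ i, (Wv i).card ≤ 2 * D) (hWl : Wl.card ≤ D) (hm : 1 ≤ m) (hDm : 4 * D ≤ m)
    (hJ : 2 ^ J ≤ m + 1) (hDJ : 8 * D ≤ 2 ^ J) (hι : 2 * m ≤ Fintype.card ι) :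
    ∃ (top : Finset (Fin m)) (V : ι → Finset (Fin m)) (A : Finset ι), Isolated Wv Wl top V A ∧
      (∀ a ∈ A, (V a).card ≤ 8 * D * 2 ^ (J + 1)) ∧
      m ≤ A.card * (1 + 8 * D * 2 ^ (J + 1) * (2 * D)) ∧
      ∀ a, a ∉ Finset.univ.biUnion Wv ∪ Wl → a ∈ A := by
  obtain ⟨top, unit, htop, hunit, hpath⟩ := exists_cut hJ
  set tch : ι → Finset (Fin m) := fun a => Finset.univ.filter fun i => a ∈ Wv i with htch
  set V : ι → Finset (Fin m) := fun a => Finset.univ.filter fun i =>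
    i ∉ top ∧ ∃ i', i' ∉ top ∧ unit i' = unit i ∧ a ∈ Wv i' with hV
  have hVcard : ∀ a, (V a).card ≤ (tch a).card * 2 ^ (J + 1) := by
    intro a
    refine (Finset.card_le_card (t := (tch a).biUnion fun i' =>
      Finset.univ.filter fun i => i ∉ top ∧ unit i = unit i') ?_).trans ?_
    · intro i hi
      simp only [hV, Finset.mem_filter, Finset.mem_univ, true_and] at hi
      obtain ⟨hi, i', -, hu, ha⟩ := hi
      simp only [Finset.mem_biUnion, Finset.mem_filter, Finset.mem_univ, true_and, htch]
      exact ⟨i', ha, hi, hu.symm⟩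
    · exact Finset.card_biUnion_le_card_mul _ _ _ fun i' _ => hunit _
  set bad1 := top.biUnion Wv with hbad1
  set bad2 := Finset.univ.filter fun a => 8 * D < (tch a).card with hbad2
  set Cand := Finset.univ \ (bad1 ∪ Wl ∪ bad2) with hCand
  have hb1 : 4 * bad1.card ≤ m + 1 := by
    have : bad1.card ≤ top.card * (2 * D) := Finset.card_biUnion_le_card_mul _ _ _ fun i _ => hWv i
    nlinarith [Nat.mul_le_mul_left top.card hDJ]
  have hb2 : 4 * bad2.card ≤ m := by
    have h1 : ∑ a, (tch a).card = ∑ i, (Wv i).card := by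
      simp_rw [htch, Finset.card_filter]
      rw [Finset.sum_comm]
      refine Finset.sum_congr rfl fun i _ => ?_
      rw [← Finset.card_filter]
      congr 1
      ext a
      simp
    have h2 : ∑ i, (Wv i).card ≤ m * (2 * D) := by
      simpa using Finset.sum_le_card_nsmul Finset.univ _ _ fun i _ => hWv i
    have h3 : bad2.card * (8 * D + 1) ≤ ∑ a ∈ bad2, (tch a).card := by
      rw [← smul_eq_mul]
      refine Finset.card_nsmul_le_sum _ _ _ fun a ha => ?_
      simp only [hbad2, Finset.mem_filter] at ha
      omega
    have h4 : ∑ a ∈ bad2, (tch a).card ≤ ∑ a, (tch a).card :=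
      Finset.sum_le_sum_of_subset (Finset.subset_univ _)
    have h5 : bad2.card * (8 * D + 1) ≤ m * (2 * D) := by omega
    rcases Nat.eq_zero_or_pos D with rfl | hD
    · omega
    · nlinarith
  have hCard : m ≤ Cand.card := by
    have h1 : Cand.card = Fintype.card ι - (bad1 ∪ Wl ∪ bad2).card := by
      rw [hCand, Finset.card_sdiff_of_subset (Finset.subset_univ _), Finset.card_univ]
    have h2 := Finset.card_union_le (bad1 ∪ Wl) bad2
    have h3 := Finset.card_union_le bad1 Wl
    omega
  obtain ⟨A, hA, hmax⟩ := Finset.exists_max_image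
    (Cand.powerset.filter fun A => ∀ a ∈ A, ∀ b ∈ A, a ≠ b → Disjoint (V a) (V b)) Finset.card
    ⟨∅, by simp⟩
  simp only [Finset.mem_filter, Finset.mem_powerset] at hA hmax
  obtain ⟨hAC, hAd⟩ := hA
  have hAC' : ∀ a ∈ A, a ∉ bad1 ∧ a ∉ Wl ∧ a ∉ bad2 := by
    intro a ha
    have := hAC ha
    simp only [hCand, Finset.mem_sdiff, Finset.mem_union] at this
    tauto
  have hVA : ∀ a ∈ A, (V a).card ≤ 8 * D * 2 ^ (J + 1) := by
    intro a ha
    refine (hVcard a).trans (Nat.mul_le_mul_right _ ?_)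
    have := (hAC' a ha).2.2
    simpa [hbad2] using this
  have hconf : ∀ c ∈ Cand, c ∉ A → ∃ a ∈ A, ¬ Disjoint (V a) (V c) := by
    intro c hc hcA
    by_contra! hno
    have := hmax (insert c A) ⟨Finset.insert_subset hc hAC, ?_⟩
    · rw [Finset.card_insert_of_notMem hcA] at this
      omega
    · intro a ha b hb hab
      rcases Finset.mem_insert.mp ha with rfl | ha' <;> rcases Finset.mem_insert.mp hb with rfl | hb'
      · exact absurd rfl hab
      · exact (hno b hb').symm
      · exact hno a ha'
      · exact hAd a ha' b hb' hab
  refine ⟨top, V, A, ⟨fun a ha => (hAC' a ha).2.1, ?_, ?_, hAd, ?_⟩, hVA, ?_, ?_⟩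
  · intro a ha i hi hai
    exact (hAC' a ha).1 (Finset.mem_biUnion.mpr ⟨i, hi, hai⟩)
  · intro a ha i hai
    have hi : i ∉ top := fun hi => (hAC' a ha).1 (Finset.mem_biUnion.mpr ⟨i, hi, hai⟩)
    simp only [hV, Finset.mem_filter, Finset.mem_univ, true_and]
    exact ⟨hi, i, hi, rfl, hai⟩
  · intro a ha i j hij
    by_cases hjt : j ∈ top
    · exact Or.inl hjt
    · obtain ⟨hi, hu⟩ := (hpath i j hij).resolve_left hjt
      right
      simp [hV, hi, hjt, hu]
  · have hsub : Cand ⊆ A ∪ A.biUnion fun a => (V a).biUnion Wv := by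
      intro c hc
      by_cases hcA : c ∈ A
      · exact Finset.mem_union_left _ hcA
      · obtain ⟨a, ha, hnd⟩ := hconf c hc hcA
        obtain ⟨i, hia, hic⟩ := Finset.not_disjoint_iff.mp hnd
        simp only [hV, Finset.mem_filter, Finset.mem_univ, true_and] at hia hic
        obtain ⟨hi, i1, hi1, hu1, ha1⟩ := hia
        obtain ⟨-, i2, hi2, hu2, hc2⟩ := hic
        refine Finset.mem_union_right _ (Finset.mem_biUnion.mpr ⟨a, ha, Finset.mem_biUnion.mpr
          ⟨i2, ?_, hc2⟩⟩)
        simp only [hV, Finset.mem_filter, Finset.mem_univ, true_and]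
        exact ⟨hi2, i1, hi1, hu1.trans hu2.symm, ha1⟩
    have h1 : ∀ a ∈ A, ((V a).biUnion Wv).card ≤ 8 * D * 2 ^ (J + 1) * (2 * D) := fun a ha =>
      (Finset.card_biUnion_le_card_mul _ _ _ fun i _ => hWv i).trans
        (Nat.mul_le_mul_right _ (hVA a ha))
    calc m ≤ Cand.card := hCard
      _ ≤ _ := Finset.card_le_card hsub
      _ ≤ _ := Finset.card_union_le _ _
      _ ≤ A.card + A.card * (8 * D * 2 ^ (J + 1) * (2 * D)) :=
        Nat.add_le_add_left (Finset.card_biUnion_le_card_mul _ _ _ h1) _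
      _ = _ := by ring
  · intro a ha
    simp only [Finset.mem_union, Finset.mem_biUnion, Finset.mem_univ, true_and, not_or,
      not_exists] at ha
    have hVa : V a = ∅ := by simp [hV, ha.1]
    by_contra haA
    have haC : a ∈ Cand := by
      simp [hCand, hbad1, hbad2, htch, ha.1, ha.2]
    obtain ⟨b, -, hb⟩ := hconf a haC haA
    exact hb (by simp [hVa])

end Isolated

/-! ### Characters modulo `p` twisted by the parity -/

section Fourier

/-- The sign `±1` that stands for a bit. -/
def bitSign (b : Bool) : ℂ := if b then -1 else 1

lemma bitSign_xor (a b : Bool) : bitSign (xor a b) = bitSign a * bitSign b := by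
  cases a <;> cases b <;> simp [bitSign]

lemma bitSign_mul_self (a : Bool) : bitSign a * bitSign a = 1 := by
  cases a <;> simp [bitSign]

lemma bitSign_mul_of_ne {a b : Bool} (h : a ≠ b) : bitSign a * bitSign b = -1 := by
  cases a <;> cases b <;> simp_all [bitSign]

lemma norm_bitSign (b : Bool) : ‖bitSign b‖ = 1 := by
  cases b <;> simp [bitSign]

lemma bitSign_odd (s : ℤ) : bitSign (decide (Odd s)) = (-1) ^ s := by
  rcases Int.even_or_odd s with h | h
  · rw [h.neg_one_zpow]
    simp [bitSign, h]
  · rw [h.neg_one_zpow]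
    simp [bitSign, h]

lemma bitParity_eq {m : ℕ} (x d : Fin m → Bool) : bitParity x = decide (Odd (signedSum x d)) := by
  have h : Even (signedSum x d - ((Finset.univ.filter fun i => x i = true).card : ℤ)) := by
    rw [even_iff_two_dvd, Finset.card_filter, signedSum]
    push_cast
    rw [← Finset.sum_sub_distrib]
    refine Finset.dvd_sum fun i _ => ?_
    split_ifs <;> norm_num
  unfold bitParity
  rw [decide_eq_decide, ← Int.odd_coe_nat]
  rw [Int.even_sub'] at h
  exact h.symm

variable {p : ℕ} [Fact p.Prime]

lemma majMod_eq_val (a : ℤ) : majMod p a = majMod p ((a : ZMod p).val : ℤ) := by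
  unfold majMod
  rw [ZMod.val_intCast, Int.emod_emod_of_dvd _ dvd_rfl]

/-- Residues below and above `p / 2` almost balance. -/
lemma sum_bitSign_majMod (hp : p ≠ 2) :
    ∑ r : ZMod p, bitSign (majMod p (r.val : ℤ)) = 1 := by
  obtain ⟨k, hk⟩ := (Fact.out : p.Prime).odd_of_ne_two hp
  have h1 : ∑ r : ZMod p, bitSign (majMod p (r.val : ℤ)) =
      ∑ i ∈ Finset.range p, bitSign (majMod p (i : ℤ)) := by
    refine Finset.sum_nbij' ZMod.val (fun i => (i : ZMod p)) ?_ ?_ ?_ ?_ ?_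
    · intro r _
      exact Finset.mem_range.mpr (ZMod.val_lt r)
    · intros; exact Finset.mem_univ _
    · intro r _
      exact ZMod.natCast_zmod_val r
    · intro i hi
      exact ZMod.val_cast_of_lt (Finset.mem_range.mp hi)
    · intros; rfl
  have h2 : ∀ i ∈ Finset.range p, bitSign (majMod p (i : ℤ)) = if i ≤ k then 1 else -1 := by
    intro i hi
    have hi' := Finset.mem_range.mp hi
    have h3 : ((i : ℤ) % (p : ℤ)) = i := Int.emod_eq_of_lt (by positivity) (by exact_mod_cast hi')
    unfold bitSign majMod
    rw [h3]
    have h4 : ((p : ℚ) / 2 ≤ ((i : ℤ) : ℚ)) ↔ ¬ i ≤ k := by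
      rw [div_le_iff₀ (by norm_num), not_le]
      have : ((p : ℚ) ≤ ((i : ℤ) : ℚ) * 2) ↔ p ≤ i * 2 := by
        push_cast
        exact_mod_cast Iff.rfl
      rw [this]
      omega
    by_cases h5 : i ≤ k
    · rw [if_pos h5, if_neg]
      simpa using fun h => h4.mp h h5
    · rw [if_neg h5, if_pos]
      simpa using h4.mpr h5
  rw [h1, Finset.sum_congr rfl h2, hk, show 2 * k + 1 = (k + 1) + k by ring, Finset.sum_range_add,
    Finset.sum_congr rfl (g := fun _ => (1 : ℂ)) fun i hi => by
      rw [if_pos (by have := Finset.mem_range.mp hi; omega)],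
    Finset.sum_congr rfl (s₁ := Finset.range k) (g := fun _ => (-1 : ℂ)) fun i hi => by
      rw [if_neg (by omega)]]
  simp

/-- The Fourier expansion of the threshold function modulo `p`. -/
lemma exists_majMod_expansion (hp : p ≠ 2) : ∃ c : ZMod p → ℂ,
    (∀ a : ℤ, bitSign (majMod p a) = ∑ j, c j * ZMod.stdAddChar (j * (a : ZMod p))) ∧
      (∀ j, ‖c j‖ ≤ 1) ∧ ‖c 0‖ ≤ 1 / p := by
  have hp0 : (p : ℂ) ≠ 0 := by exact_mod_cast (Fact.out : p.Prime).ne_zero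
  have hp0' : (p : ℝ) ≠ 0 := by exact_mod_cast (Fact.out : p.Prime).ne_zero
  set M : ZMod p → ℂ := fun r => bitSign (majMod p (r.val : ℤ)) with hM
  refine ⟨fun j => (1 / p) * ∑ r, M r * ZMod.stdAddChar (-(j * r)), ?_, ?_, ?_⟩
  · intro a
    have horth : ∀ r : ZMod p, ∑ j : ZMod p, ZMod.stdAddChar (j * ((a : ZMod p) - r)) =
        if (a : ZMod p) - r = 0 then (p : ℂ) else 0 := by
      intro r
      rw [AddChar.sum_mulShift _ (ZMod.isPrimitive_stdAddChar p), ZMod.card]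
      push_cast
      rfl
    have h1 : ∑ j : ZMod p, (1 / p) * (∑ r, M r * ZMod.stdAddChar (-(j * r))) *
        ZMod.stdAddChar (j * (a : ZMod p)) =
        (1 / p) * ∑ r, M r * ∑ j : ZMod p, ZMod.stdAddChar (j * ((a : ZMod p) - r)) := by
      simp_rw [mul_assoc, ← Finset.mul_sum, Finset.sum_mul]
      congr 1
      rw [Finset.sum_comm]
      refine Finset.sum_congr rfl fun r _ => ?_
      rw [Finset.mul_sum]
      refine Finset.sum_congr rfl fun j _ => ?_
      rw [mul_assoc, ← AddChar.map_add_eq_mul]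
      congr 2
      ring
    rw [h1]
    simp_rw [horth, sub_eq_zero, mul_ite, mul_zero]
    rw [Finset.sum_ite_eq Finset.univ (a : ZMod p), if_pos (Finset.mem_univ _), majMod_eq_val, hM]
    field_simp
  · intro j
    rw [norm_mul]
    have : ‖∑ r, M r * ZMod.stdAddChar (-(j * r))‖ ≤ p := by
      refine (norm_sum_le _ _).trans ?_
      simp_rw [norm_mul, AddChar.norm_apply, mul_one, hM, norm_bitSign]
      simp [ZMod.card]
    rw [norm_div, norm_one, Complex.norm_natCast]
    calc 1 / (p : ℝ) * _ ≤ 1 / (p : ℝ) * p := by gcongr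
      _ = 1 := by field_simp
  · simp_rw [zero_mul, neg_zero, AddChar.map_zero_eq_one, mul_one, hM, sum_bitSign_majMod hp]
    simp

/-- A character modulo `p` times the sign of the parity: a character modulo `2 * p`. -/
noncomputable def signedPhase (j : ZMod p) (s : ℤ) : ℂ :=
  ZMod.stdAddChar (j * (s : ZMod p)) * (-1) ^ s

lemma signedPhase_add (j : ZMod p) (s t : ℤ) :
    signedPhase j (s + t) = signedPhase j s * signedPhase j t := by
  unfold signedPhase
  rw [Int.cast_add, mul_add, AddChar.map_add_eq_mul, zpow_add₀ (by norm_num)]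
  ring

lemma signedPhase_zero (j : ZMod p) : signedPhase j 0 = 1 := by
  simp [signedPhase]

lemma signedPhase_sum {κ : Type*} (j : ZMod p) (A : Finset κ) (s : κ → ℤ) :
    signedPhase j (∑ a ∈ A, s a) = ∏ a ∈ A, signedPhase j (s a) := by
  classical
  induction A using Finset.induction_on with
  | empty => simp [signedPhase_zero]
  | insert a A ha ih => rw [Finset.sum_insert ha, Finset.prod_insert ha, signedPhase_add, ih]

lemma norm_signedPhase (j : ZMod p) (s : ℤ) : ‖signedPhase j s‖ = 1 := by
  rw [signedPhase, norm_mul, AddChar.norm_apply, norm_zpow, norm_neg, norm_one, one_zpow, one_mul]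

/-- Different roots of unity of order `n` have distance at least `2 / n`: the powers of a root
close to `1` would otherwise not sum to zero. -/
lemma two_le_mul_norm_sub_one {z : ℂ} {n : ℕ} (hn : 0 < n) (hz : z ^ n = 1) (h1 : z ≠ 1) :
    2 ≤ n * ‖z - 1‖ := by
  have hnorm : ‖z‖ = 1 := Complex.norm_eq_one_of_pow_eq_one hz hn.ne'
  have hsum : ∑ k ∈ Finset.range n, z ^ k = 0 := by
    have := geom_sum_mul z n
    rw [hz, sub_self, mul_eq_zero] at this
    exact this.resolve_right (sub_ne_zero.mpr h1)
  have hk : ∀ k : ℕ, ‖z ^ k - 1‖ ≤ k * ‖z - 1‖ := by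
    intro k
    rw [← geom_sum_mul, norm_mul]
    gcongr
    refine (norm_sum_le _ _).trans ?_
    simp [hnorm]
  have h2 : (n : ℝ) ≤ ∑ k ∈ Finset.range n, (k : ℝ) * ‖z - 1‖ := by
    have h3 : ∑ k ∈ Finset.range n, (z ^ k - 1) = -(n : ℂ) := by
      rw [Finset.sum_sub_distrib, hsum]
      simp
    calc (n : ℝ) = ‖∑ k ∈ Finset.range n, (z ^ k - 1)‖ := by
          rw [h3, norm_neg, Complex.norm_natCast]
      _ ≤ _ := (norm_sum_le _ _).trans (Finset.sum_le_sum fun k _ => hk k)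
  have h4 : (∑ k ∈ Finset.range n, (k : ℝ)) * 2 ≤ (n : ℝ) * n := by
    have := Finset.sum_range_id_mul_two n
    have h5 : (∑ i ∈ Finset.range n, i) * 2 ≤ n * n := by
      rw [this]; exact Nat.mul_le_mul_left _ (Nat.sub_le _ _)
    have h6 : (((∑ i ∈ Finset.range n, i) * 2 : ℕ) : ℝ) ≤ ((n * n : ℕ) : ℝ) := Nat.cast_le.mpr h5
    push_cast at h6
    exact h6
  rw [← Finset.sum_mul] at h2
  have hn' : (0 : ℝ) < n := by exact_mod_cast hn
  have h6 : (n : ℝ) * 2 ≤ n * (n * ‖z - 1‖) := by nlinarith [norm_nonneg (z - 1)]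
  exact le_of_mul_le_mul_left h6 hn'

lemma signedPhase_ne {j : ZMod p} (hp : p ≠ 2) (hj : j ≠ 0) {s t : ℤ} (hst : s ≠ t)
    (hlt : |s - t| < p) : signedPhase j s ≠ signedPhase j t := by
  intro h
  have hsq : ∀ s : ℤ, signedPhase j s ^ 2 = ZMod.stdAddChar (2 * (j * (s : ZMod p))) := by
    intro s
    rw [signedPhase, mul_pow, ← zpow_natCast ((-1 : ℂ) ^ s) 2, ← zpow_mul,
      (Even.mul_left (by simp : Even ((2 : ℕ) : ℤ)) s).neg_one_zpow, mul_one,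
      ← AddChar.map_nsmul_eq_pow]
    simp
  have h2 := congrArg (· ^ 2) h
  simp only [hsq] at h2
  have h3 := ZMod.injective_stdAddChar h2
  have h20 : (2 : ZMod p) ≠ 0 := by
    intro h0
    have : p ∣ 2 := (ZMod.natCast_eq_zero_iff 2 p).mp (by exact_mod_cast h0)
    exact hp ((Nat.prime_dvd_prime_iff_eq Fact.out Nat.prime_two).mp this)
  have h4 : (s : ZMod p) = t := mul_left_cancel₀ hj (mul_left_cancel₀ h20 h3)
  have h5 : (p : ℤ) ∣ s - t := by
    rw [← ZMod.intCast_zmod_eq_zero_iff_dvd, Int.cast_sub, h4, sub_self]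
  exact hst (sub_eq_zero.mp (Int.eq_zero_of_abs_lt_dvd h5 hlt))

lemma signedPhase_pow (j : ZMod p) (s : ℤ) : signedPhase j s ^ (2 * p) = 1 := by
  rw [signedPhase, mul_pow, ← zpow_natCast ((-1 : ℂ) ^ s), ← zpow_mul,
    (Even.mul_left (by simp : Even ((2 * p : ℕ) : ℤ)) s).neg_one_zpow, mul_one,
    ← AddChar.map_nsmul_eq_pow]
  simp

/-- Averaging over a bit that changes the sum contracts every twisted character. -/
lemma norm_avg_signedPhase_le {j : ZMod p} (hp : p ≠ 2) (hj : j ≠ 0) {w : Bool → ℝ}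
    (hw0 : ∀ c, 0 ≤ w c) (hw : w true + w false = 1) {s : Bool → ℤ} (hs : s true ≠ s false)
    (hlt : |s true - s false| < p) :
    ‖∑ c, w c • signedPhase j (s c)‖ ≤ Real.exp (-(w true * w false / (2 * p ^ 2))) := by
  have hp0 : (0 : ℝ) < p := by exact_mod_cast (Fact.out : p.Prime).pos
  set z := signedPhase j (s true) with hz
  set y := signedPhase j (s false) with hy
  have hzn : ‖z‖ = 1 := norm_signedPhase _ _
  have hyn : ‖y‖ = 1 := norm_signedPhase _ _
  have hy0 : y ≠ 0 := by rw [← norm_ne_zero_iff, hyn]; norm_num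
  have hdist : 1 ≤ p * ‖z - y‖ := by
    have h1 := two_le_mul_norm_sub_one (z := z / y) (n := 2 * p)
      (Nat.mul_pos two_pos (Fact.out : p.Prime).pos)
      (by rw [div_pow, hz, hy, signedPhase_pow, signedPhase_pow, div_one])
      (by rw [Ne, div_eq_one_iff_eq hy0]; exact signedPhase_ne hp hj hs hlt)
    have h2 : ‖z / y - 1‖ = ‖z - y‖ := by
      rw [div_sub_one hy0, norm_div, hyn, div_one]
    rw [h2] at h1
    push_cast at h1
    nlinarith
  have hsq : ‖w true • z + w false • y‖ ^ 2 = 1 - w true * w false * ‖z - y‖ ^ 2 := by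
    have e1 : ‖z‖ ^ 2 = 1 := by rw [hzn]; norm_num
    have e2 : ‖y‖ ^ 2 = 1 := by rw [hyn]; norm_num
    rw [Complex.sq_norm, Complex.normSq_apply] at e1 e2 ⊢
    rw [Complex.sq_norm, Complex.normSq_apply]
    simp only [Complex.add_re, Complex.add_im, Complex.sub_re, Complex.sub_im, Complex.smul_re,
      Complex.smul_im, smul_eq_mul]
    have hwf : w false = 1 - w true := by linarith
    rw [hwf]
    linear_combination (w true) * e1 + (1 - w true) * e2
  rw [Fintype.sum_bool]
  have hww : 0 ≤ w true * w false := mul_nonneg (hw0 _) (hw0 _)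
  have h1 : ‖w true • z + w false • y‖ ^ 2 ≤
      Real.exp (-(w true * w false / (2 * p ^ 2))) ^ 2 := by
    rw [hsq, ← Real.exp_nat_mul]
    have h2 : 1 / (p : ℝ) ^ 2 ≤ ‖z - y‖ ^ 2 := by
      rw [div_le_iff₀ (by positivity)]
      nlinarith
    have h3 := Real.add_one_le_exp (((2 : ℕ) : ℝ) * -(w true * w false / (2 * p ^ 2)))
    refine le_trans ?_ h3
    have h4 : ((2 : ℕ) : ℝ) * -(w true * w false / (2 * p ^ 2)) = -(w true * w false * (1 / p ^ 2)) := by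
      push_cast; field_simp
    rw [h4]
    nlinarith [mul_le_mul_of_nonneg_left h2 hww]
  exact le_of_sq_le_sq h1 (Real.exp_pos _).le

end Fourier

/-! ### The response of the outputs to isolated inputs -/

section Response

/-- The contribution of a vertex to the signed sum. -/
def vertexTerm {m : ℕ} (x d : Fin m → Bool) (i : Fin m) : ℤ :=
  if x i then (if pathParity d i then -1 else 1) else 0

lemma signedSum_eq_sum_vertexTerm {m : ℕ} (x d : Fin m → Bool) :
    signedSum x d = ∑ i, vertexTerm x d i := rfl

lemma abs_vertexTerm_le {m : ℕ} (x d : Fin m → Bool) (i : Fin m) : |vertexTerm x d i| ≤ 1 := by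
  unfold vertexTerm
  split_ifs <;> simp

lemma vertexTerm_eq_one_iff {m : ℕ} {x d : Fin m → Bool} {i : Fin m} :
    vertexTerm x d i = 1 ↔ x i = true ∧ pathParity d i = false := by
  unfold vertexTerm
  split_ifs <;> simp_all

variable {ι : Type*} [DecidableEq ι] {m : ℕ}

/-- The summand of the signed sum that comes from the vertices in `V a`. -/
def partSum (x d : (ι → Bool) → Fin m → Bool) (V : ι → Finset (Fin m)) (a : ι) (u : ι → Bool) : ℤ :=
  ∑ i ∈ V a, vertexTerm (x u) (d u) i

/-- The isolated inputs whose flipping does not change any output. -/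
def inertInputs (x d : (ι → Bool) → Fin m → Bool) (V : ι → Finset (Fin m)) (A : Finset ι)
    (u : ι → Bool) : Finset ι :=
  A.filter fun a => ∀ i ∈ V a, x (Function.update u a true) i = x (Function.update u a false) i ∧
    d (Function.update u a true) i = d (Function.update u a false) i

/-- The isolated inputs whose flipping changes the signed sum. -/
def activeInputs (x d : (ι → Bool) → Fin m → Bool) (V : ι → Finset (Fin m)) (A : Finset ι)
    (u : ι → Bool) : Finset ι :=
  A.filter fun a => partSum x d V a (Function.update u a true) ≠
    partSum x d V a (Function.update u a false)

lemma DependsOn.update_eq {β : Type*} {g : (ι → Bool) → β} {W : Finset ι}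
    (hg : DependsOn g (W : Set ι)) {b : ι} (hb : b ∉ W) (u : ι → Bool) (c : Bool) :
    g (Function.update u b c) = g u :=
  hg fun k hk => Function.update_of_ne (by rintro rfl; exact hb hk) _ _

variable {Wv : Fin m → Finset ι} {Wl : Finset ι} {top : Finset (Fin m)} {V : ι → Finset (Fin m)}
  {A : Finset ι} (H : Isolated Wv Wl top V A) {x d : (ι → Bool) → Fin m → Bool}
  (hx : ∀ i, DependsOn (fun u => x u i) (Wv i : Set ι))
  (hd : ∀ i, DependsOn (fun u => d u i) (Wv i : Set ι))

include H hx in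
lemma x_update {b : ι} (hb : b ∈ A) {i : Fin m} (hi : i ∉ V b) (u : ι → Bool) (c : Bool) :
    x (Function.update u b c) i = x u i :=
  DependsOn.update_eq (hx i) (fun h => hi (H.mem b hb i h)) u c

include H hd in
lemma pathParity_update {b : ι} (hb : b ∈ A) {i : Fin m} (hi : i ∉ V b) (u : ι → Bool) (c : Bool) :
    pathParity (d (Function.update u b c)) i = pathParity (d u) i := by
  refine pathParity_congr fun j hj => ?_
  rcases H.path b hb i j hj with h | h
  · exact DependsOn.update_eq (hd j) (H.notMem_of_top b hb j h) u c
  · exact DependsOn.update_eq (hd j) (fun h' => hi (h.mpr (H.mem b hb j h'))) u c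

include H hx hd in
lemma vertexTerm_update {b : ι} (hb : b ∈ A) {i : Fin m} (hi : i ∉ V b) (u : ι → Bool) (c : Bool) :
    vertexTerm (x (Function.update u b c)) (d (Function.update u b c)) i =
      vertexTerm (x u) (d u) i := by
  unfold vertexTerm
  rw [x_update H hx hb hi, pathParity_update H hd hb hi]

include H hx hd in
lemma partSum_update {a b : ι} (ha : a ∈ A) (hb : b ∈ A) (hba : b ≠ a) (u : ι → Bool) (c : Bool) :
    partSum x d V a (Function.update u b c) = partSum x d V a u :=
  Finset.sum_congr rfl fun _ hi => vertexTerm_update H hx hd hb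
    (Finset.disjoint_left.mp (H.disj a ha b hb hba.symm) hi) u c

include H hx hd in
lemma inertInputs_update {b : ι} (hb : b ∈ A) (u : ι → Bool) (c : Bool) :
    inertInputs x d V A (Function.update u b c) = inertInputs x d V A u := by
  refine Finset.filter_congr fun a ha => ?_
  by_cases hba : b = a
  · subst hba
    simp only [Function.update_idem]
  · refine forall₂_congr fun i hi => ?_
    have hib : i ∉ V b := Finset.disjoint_left.mp (H.disj a ha b hb (Ne.symm hba)) hi
    simp only [Function.update_comm hba, x_update H hx hb hib, x_update H hd hb hib]

include H hx hd in
lemma activeInputs_update {b : ι} (hb : b ∈ A) (u : ι → Bool) (c : Bool) :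
    activeInputs x d V A (Function.update u b c) = activeInputs x d V A u := by
  refine Finset.filter_congr fun a ha => ?_
  by_cases hba : b = a
  · subst hba
    simp only [Function.update_idem]
  · simp only [Function.update_comm hba, partSum_update H hx hd ha hb hba]

lemma update_eq_of_update_eq {β : Type*} {g : (ι → Bool) → β} {a : ι} {u : ι → Bool}
    (h : g (Function.update u a true) = g (Function.update u a false)) (c : Bool) :
    g (Function.update u a c) = g u := by
  have hc : g (Function.update u a c) = g (Function.update u a (u a)) := by
    cases c <;> cases u a <;> simp [h]
  rw [hc, Function.update_eq_self]

include H hd in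
/-- Set vertex bits and even path parities on `V a` make the summand of `V a` as large as it can be,
and no other pattern does; so if `V a` shows this pattern and `a` is not inert, flipping `a` changes
the signed sum. -/
lemma mem_activeInputs {a : ι} (ha : a ∈ A) {u : ι → Bool} (hF : a ∉ inertInputs x d V A u)
    (hpat : ∀ i ∈ V a, x u i = true ∧ pathParity (d u) i = false) :
    a ∈ activeInputs x d V A u := by
  refine Finset.mem_filter.mpr ⟨ha, fun heq => hF (Finset.mem_filter.mpr ⟨ha, ?_⟩)⟩
  have key : ∀ c, ∀ i ∈ V a, x (Function.update u a c) i = x u i ∧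
      d (Function.update u a c) i = d u i := by
    intro c
    have h1 : partSum x d V a (Function.update u a c) = partSum x d V a u :=
      update_eq_of_update_eq heq c
    have h2 : partSum x d V a u = ∑ i ∈ V a, (1 : ℤ) :=
      Finset.sum_congr rfl fun i hi => vertexTerm_eq_one_iff.mpr (hpat i hi)
    rw [h2] at h1
    have h3 := (Finset.sum_eq_sum_iff_of_le fun i _ => (le_abs_self _).trans
      (abs_vertexTerm_le (x (Function.update u a c)) (d (Function.update u a c)) i)).mp h1
    have h4 : ∀ i ∈ V a, x (Function.update u a c) i = true ∧
        pathParity (d (Function.update u a c)) i = false := fun i hi =>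
      vertexTerm_eq_one_iff.mp (h3 i hi)
    have h5 := eqOn_of_pathParity_eqOn (d := d (Function.update u a c)) (d' := d u)
      (T := (top : Set (Fin m))) (V := (V a : Set (Fin m)))
      (fun j hj => DependsOn.update_eq (hd j) (H.notMem_of_top a ha j hj) u c)
      (fun i hi j hj => (H.path a ha i j hj).imp id fun h => h.mp hi)
      (fun i hi => (h4 i hi).2.trans (hpat i hi).2.symm)
    exact fun i hi => ⟨(h4 i hi).1.trans (hpat i hi).1.symm, h5 i hi⟩
  intro i hi
  exact ⟨((key true i hi).1).trans (key false i hi).1.symm,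
    ((key true i hi).2).trans (key false i hi).2.symm⟩

omit [DecidableEq ι] in
lemma abs_partSum_sub_le (a : ι) (u v : ι → Bool) :
    |partSum x d V a u - partSum x d V a v| ≤ 2 * (V a).card := by
  have h : ∀ u, |partSum x d V a u| ≤ (V a).card := fun u =>
    (Finset.abs_sum_le_sum_abs _ _).trans
      ((Finset.sum_le_sum fun i _ => abs_vertexTerm_le (x u) (d u) i).trans (by simp))
  have h1 := abs_le.mp (h u)
  have h2 := abs_le.mp (h v)
  rw [abs_le]
  constructor <;> linarith

omit [DecidableEq ι] in
include H in
lemma signedSum_eq_add (u : ι → Bool) :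
    signedSum (x u) (d u) = ∑ i ∈ Finset.univ \ A.biUnion V, vertexTerm (x u) (d u) i +
      ∑ a ∈ A, partSum x d V a u := by
  rw [signedSum_eq_sum_vertexTerm, ← Finset.sum_sdiff (Finset.subset_univ (A.biUnion V)),
    Finset.sum_biUnion fun a ha b hb hab => H.disj a ha b hb hab]
  rfl

include H in
/-- The outputs do not react to any change of the inert inputs. -/
lemma eq_of_eqOn_compl_inertInputs {u v : ι → Bool} (huv : ∀ k ∉ inertInputs x d V A u, v k = u k)
    {y : (ι → Bool) → Fin m → Bool} (hy : ∀ i, DependsOn (fun u => y u i) (Wv i : Set ι))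
    (hinert : ∀ a ∈ inertInputs x d V A u, ∀ i ∈ V a,
      y (Function.update u a true) i = y (Function.update u a false) i) : y v = y u := by
  have hsub : ∀ a ∈ inertInputs x d V A u, a ∈ A := fun a h => (Finset.mem_filter.mp h).1
  funext i
  by_cases hi : ∃ b ∈ inertInputs x d V A u, i ∈ V b
  · obtain ⟨b, hb, hib⟩ := hi
    rw [← update_eq_of_update_eq (g := fun u => y u i) (hinert b hb i hib) (v b)]
    refine hy i fun k hk => ?_
    by_cases hkb : k = b
    · subst hkb
      simp
    · rw [Function.update_of_ne hkb]
      refine huv k fun hkF => ?_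
      exact Finset.disjoint_left.mp (H.disj k (hsub k hkF) b (hsub b hb) hkb)
        (H.mem k (hsub k hkF) i hk) hib
  · push Not at hi
    exact hy i fun k hk => huv k fun hkF => hi k hkF (H.mem k (hsub k hkF) i hk)

end Response

section Bias

variable {ι : Type*} [Fintype ι] [DecidableEq ι] {m : ℕ}

lemma norm_expect_le {w : Bool → ℝ} (hw0 : ∀ c, 0 ≤ w c) (hw : w true + w false = 1)
    {g : (ι → Bool) → ℂ} {r : ℝ} (hg : ∀ u, ‖g u‖ ≤ r) : ‖expect w g‖ ≤ r := by
  refine (norm_sum_le _ _).trans ?_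
  calc ∑ u : ι → Bool, ‖prodWeight w u • g u‖ ≤ ∑ u : ι → Bool, prodWeight w u * r := by
        refine Finset.sum_le_sum fun u _ => ?_
        rw [norm_smul, Real.norm_of_nonneg (prodWeight_nonneg hw0 u)]
        exact mul_le_mul_of_nonneg_left (hg u) (prodWeight_nonneg hw0 u)
    _ = r := by rw [← Finset.sum_mul, sum_prodWeight hw, one_mul]

/-- Where enough inputs are active (with `r` small accordingly), the sign of `majMod` of the signed sum times its parity is
almost unbiased, against any function `G` that ignores the isolated inputs. -/
lemma norm_expect_bitSign_le {p : ℕ} [Fact p.Prime] (hp : p ≠ 2) {w : Bool → ℝ}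
    (hw0 : ∀ c, 0 ≤ w c) (hw : w true + w false = 1)
    {Wv : Fin m → Finset ι} {Wl : Finset ι} {top : Finset (Fin m)} {V : ι → Finset (Fin m)}
    {A : Finset ι} (H : Isolated Wv Wl top V A) {x d : (ι → Bool) → Fin m → Bool}
    (hx : ∀ i, DependsOn (fun u => x u i) (Wv i : Set ι))
    (hd : ∀ i, DependsOn (fun u => d u i) (Wv i : Set ι))
    (hV : ∀ a ∈ A, 2 * (V a).card < p)
    {G : (ι → Bool) → ℂ} (hG1 : ∀ u, ‖G u‖ ≤ 1)
    (hG : ∀ a ∈ A, ∀ u c, G (Function.update u a c) = G u) {r : ℝ} (hr : 0 ≤ r)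
    (hGr : ∀ u, G u ≠ 0 →
      Real.exp (-(w true * w false / (2 * p ^ 2)) * (activeInputs x d V A u).card) ≤ r) :
    ‖expect w fun u => G u * (bitSign (majMod p (signedSum (x u) (d u))) *
      (-1) ^ signedSum (x u) (d u))‖ ≤ 1 / p + p * r := by
  obtain ⟨c, hc, hc1, hc0⟩ := exists_majMod_expansion (p := p) hp
  set S : (ι → Bool) → ℤ := fun u => signedSum (x u) (d u) with hS
  have hexp : (expect w fun u => G u * (bitSign (majMod p (S u)) * (-1) ^ S u)) =
      ∑ j, c j * expect w fun u => G u * signedPhase j (S u) := by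
    have h1 : ∀ u, G u * (bitSign (majMod p (S u)) * (-1) ^ S u) =
        ∑ j, c j * (G u * signedPhase j (S u)) := by
      intro u
      rw [hc, Finset.sum_mul, Finset.mul_sum]
      refine Finset.sum_congr rfl fun j _ => ?_
      unfold signedPhase
      ring
    simp_rw [h1]
    rw [expect_sum]
    refine Finset.sum_congr rfl fun j _ => ?_
    unfold expect
    rw [Finset.mul_sum]
    exact Finset.sum_congr rfl fun u _ => (mul_smul_comm _ _ _).symm
  have hj0 : ∀ j : ZMod p, ‖expect w fun u => G u * signedPhase j (S u)‖ ≤ 1 := fun j =>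
    norm_expect_le hw0 hw fun u => by
      rw [norm_mul, norm_signedPhase, mul_one]
      exact hG1 u
  have hj : ∀ j : ZMod p, j ≠ 0 → ‖expect w fun u => G u * signedPhase j (S u)‖ ≤ r := by
    intro j hj
    set rest : (ι → Bool) → ℤ := fun u =>
      ∑ i ∈ Finset.univ \ A.biUnion V, vertexTerm (x u) (d u) i with hrest
    have hfac : ∀ u, G u * signedPhase j (S u) =
        (G u * signedPhase j (rest u)) * ∏ a ∈ A, signedPhase j (partSum x d V a u) := by
      intro u
      rw [hS]
      dsimp only
      rw [signedSum_eq_add H u, signedPhase_add, signedPhase_sum j A, mul_assoc]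
    simp_rw [hfac]
    rw [expect_prod_resample hw A]
    · refine norm_expect_le hw0 hw fun u => ?_
      rw [norm_mul, norm_mul, norm_signedPhase, mul_one, norm_prod]
      by_cases hu : G u = 0
      · rw [hu, norm_zero, zero_mul]
        exact hr
      refine le_trans ?_ (hGr u hu)
      have hprod : ∏ a ∈ A, ‖∑ b, w b • signedPhase j (partSum x d V a (Function.update u a b))‖ ≤
          ∏ a ∈ A, if partSum x d V a (Function.update u a true) ≠
              partSum x d V a (Function.update u a false)
            then Real.exp (-(w true * w false / (2 * p ^ 2))) else 1 := by
        refine Finset.prod_le_prod (fun _ _ => norm_nonneg _) fun a ha => ?_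
        split_ifs with hne
        · refine norm_avg_signedPhase_le hp hj hw0 hw
            (s := fun b => partSum x d V a (Function.update u a b)) hne ?_
          refine lt_of_le_of_lt (abs_partSum_sub_le a _ _) ?_
          exact_mod_cast hV a ha
        · refine (norm_sum_le _ _).trans ?_
          simp_rw [norm_smul, norm_signedPhase, mul_one, Real.norm_of_nonneg (hw0 _)]
          rw [Fintype.sum_bool, hw]
      rw [Finset.prod_ite, Finset.prod_const_one, mul_one, Finset.prod_const, ← Real.exp_nat_mul,
        mul_comm] at hprod
      calc _ ≤ 1 * ∏ a ∈ A, ‖∑ b, w b • signedPhase j (partSum x d V a (Function.update u a b))‖ :=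
            mul_le_mul_of_nonneg_right (hG1 u) (Finset.prod_nonneg fun _ _ => norm_nonneg _)
        _ ≤ _ := by rw [one_mul]; exact hprod
    · intro a ha u b
      have : rest (Function.update u a b) = rest u := by
        refine Finset.sum_congr rfl fun i hi => vertexTerm_update H hx hd ha (fun hia => ?_) u b
        exact (Finset.mem_sdiff.mp hi).2 (Finset.mem_biUnion.mpr ⟨a, ha, hia⟩)
      rw [hG a ha, this]
    · intro a ha b hb hba u c'
      rw [partSum_update H hx hd ha hb hba]
  rw [hexp]
  refine (norm_sum_le _ _).trans ?_
  rw [← Finset.add_sum_erase _ _ (Finset.mem_univ (0 : ZMod p))]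
  refine add_le_add ?_ ?_
  · rw [norm_mul]
    calc _ ≤ 1 / (p : ℝ) * 1 := mul_le_mul hc0 (hj0 0) (norm_nonneg _) (by positivity)
      _ = _ := mul_one _
  · refine (Finset.sum_le_card_nsmul _ _ r fun j hjm => ?_).trans ?_
    · rw [norm_mul]
      calc _ ≤ 1 * r := mul_le_mul (hc1 j) (hj j (Finset.ne_of_mem_erase hjm)) (norm_nonneg _)
            zero_le_one
        _ = r := one_mul r
    · rw [nsmul_eq_mul]
      refine mul_le_mul_of_nonneg_right ?_ hr
      have : (Finset.univ.erase (0 : ZMod p)).card ≤ p :=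
        (Finset.card_erase_le).trans (by simp [ZMod.card])
      exact_mod_cast this

end Bias

/-! ### From measures to expectations over bits -/

section Measures

lemma le_tvDistance {Ω : Type*} [MeasurableSpace Ω] (μ ν : Measure Ω) [IsProbabilityMeasure μ]
    [IsProbabilityMeasure ν] (T : Set Ω) : μ.real T - ν.real T ≤ tvDistance μ ν := by
  refine (le_abs_self _).trans (le_ciSup (f := fun T : Set Ω => |μ.real T - ν.real T|) ⟨1, ?_⟩ T)
  rintro _ ⟨S, rfl⟩
  have h1 : μ.real S ≤ 1 := measureReal_le_one
  have h2 : ν.real S ≤ 1 := measureReal_le_one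
  have h3 : 0 ≤ μ.real S := measureReal_nonneg
  have h4 : 0 ≤ ν.real S := measureReal_nonneg
  exact abs_le.mpr ⟨by linarith, by linarith⟩

/-- The probabilities of the two values of a biased bit. -/
noncomputable def bitLaw (b : ℝ) (c : Bool) : ℝ := if c then 1 / 2 - b else 1 / 2 + b

lemma bitLaw_nonneg {b : ℝ} (hb : |b| ≤ 1 / 2) (c : Bool) : 0 ≤ bitLaw b c := by
  have := abs_le.mp hb
  unfold bitLaw
  split_ifs <;> linarith

lemma bitLaw_add (b : ℝ) : bitLaw b true + bitLaw b false = 1 := by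
  simp [bitLaw]
  ring

lemma biasedBit_real_singleton (b : ℝ) (hb : |b| ≤ 1 / 2) (c : Bool) :
    (biasedBit b hb).real {c} = bitLaw b c := by
  unfold biasedBit bitLaw
  rw [bernoulliMeasure_real_apply _ (measurableSet_singleton c)]
  cases c <;> simp
  ring

instance (b : ℝ) (hb : |b| ≤ 1 / 2) : IsProbabilityMeasure (biasedBit b hb) := by
  unfold biasedBit
  infer_instance

instance (b : ℝ) (hb : |b| ≤ 1 / 2) (ℓ : ℕ) : IsProbabilityMeasure (biasedBits b hb ℓ) := by
  unfold biasedBits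
  infer_instance

lemma biasedBits_real_singleton (b : ℝ) (hb : |b| ≤ 1 / 2) (ℓ : ℕ) (u : Fin ℓ → Bool) :
    (biasedBits b hb ℓ).real {u} = prodWeight (bitLaw b) u := by
  unfold biasedBits prodWeight
  rw [measureReal_def, Measure.pi_singleton, ENNReal.toReal_prod]
  exact Finset.prod_congr rfl fun i _ => biasedBit_real_singleton b hb (u i)

open scoped Classical in
lemma real_map_eq_sum {α β : Type*} [Fintype α] [MeasurableSpace α] [MeasurableSingletonClass α]
    [MeasurableSpace β] [DiscreteMeasurableSpace β] (μ : Measure α) [IsFiniteMeasure μ]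
    (f : α → β) (T : Set β) :
    (μ.map f).real T = ∑ u, μ.real {u} * (if f u ∈ T then 1 else 0) := by
  rw [measureReal_def, Measure.map_apply (measurable_of_countable f) (MeasurableSet.of_discrete),
    ← measureReal_def]
  have h : f ⁻¹' T = ((Finset.univ.filter fun u => f u ∈ T : Finset α) : Set α) := by
    ext; simp
  rw [h, ← sum_measureReal_singleton, Finset.sum_filter]
  simp

open scoped Classical in
lemma map_biasedBits_real (b : ℝ) (hb : |b| ≤ 1 / 2) {ℓ n : ℕ} (f : (Fin ℓ → Bool) → (Fin n → Bool))
    (T : Set (Fin n → Bool)) : ((biasedBits b hb ℓ).map f).real T =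
      expect (bitLaw b) fun u => if f u ∈ T then (1 : ℝ) else 0 := by
  rw [real_map_eq_sum]
  exact Finset.sum_congr rfl fun u _ => by rw [biasedBits_real_singleton]; rfl

open scoped Classical in
lemma targetDist_real (p N : ℕ) (T : Set (Fin (N + 1) → Bool)) : (targetDist p N).real T =
    expect (fun _ => 1 / 2) fun z : Fin N → Bool =>
      if (Fin.snoc z (pmMajMod p z) : Fin (N + 1) → Bool) ∈ T then (1 : ℝ) else 0 := by
  unfold targetDist
  rw [real_map_eq_sum]
  refine Finset.sum_congr rfl fun z _ => ?_
  rw [measureReal_def, PMF.toMeasure_apply_singleton _ _ (measurableSet_singleton z)]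
  simp [prodWeight]

end Measures

/-! ### The information in a biased bit -/

section Entropy

lemma negMulLog_le_one_sub {x : ℝ} (hx : 0 ≤ x) : Real.negMulLog x ≤ 1 - x := by
  rcases hx.eq_or_lt with rfl | hx
  · simp
  · have h := Real.one_sub_inv_le_log_of_pos hx
    have : x * x⁻¹ = 1 := mul_inv_cancel₀ hx.ne'
    unfold Real.negMulLog
    nlinarith

lemma neg_log_le {x : ℝ} (hx : 0 < x) : -Real.log x ≤ 2 / Real.sqrt x := by
  have hs : 0 < Real.sqrt x := Real.sqrt_pos.mpr hx
  have h := Real.one_sub_inv_le_log_of_pos hs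
  rw [Real.log_sqrt hx.le] at h
  have : 2 / Real.sqrt x = 2 * (Real.sqrt x)⁻¹ := div_eq_mul_inv _ _
  rw [this]
  linarith

lemma negMulLog_le_two_sqrt {x : ℝ} (hx : 0 ≤ x) : Real.negMulLog x ≤ 2 * Real.sqrt x := by
  rcases hx.eq_or_lt with rfl | hx
  · simp
  · have h := mul_le_mul_of_nonneg_left (neg_log_le hx) hx.le
    have h2 : x * (2 / Real.sqrt x) = 2 * Real.sqrt x := by
      rw [mul_div_left_comm, Real.div_sqrt]
    unfold Real.negMulLog
    linarith

lemma mul_neg_log_sq_le {x : ℝ} (hx : 0 ≤ x) (h1 : x ≤ 1) : x * (-Real.log x) ^ 2 ≤ 4 := by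
  rcases hx.eq_or_lt with rfl | hx
  · simp
  · have h := pow_le_pow_left₀ (by linarith [Real.log_nonpos hx.le h1]) (neg_log_le hx) 2
    rw [div_pow, Real.sq_sqrt hx.le] at h
    calc x * (-Real.log x) ^ 2 ≤ x * (2 ^ 2 / x) := mul_le_mul_of_nonneg_left h hx.le
      _ = 4 := by field_simp; norm_num

variable {b k : ℝ} (hb : |b| ≤ 1 / 2) (hk : 0 < k) (hent : bitEntropy (biasedBit b hb) = 1 / k)

include hent in
lemma sum_negMulLog_bitLaw : ∑ c, Real.negMulLog (bitLaw b c) = Real.log 2 / k := by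
  unfold bitEntropy at hent
  simp_rw [biasedBit_real_singleton] at hent
  rw [← Finset.sum_div, div_eq_iff (Real.log_pos one_lt_two).ne'] at hent
  rw [hent]
  ring

include hk hent in
lemma bitLaw_pos (c : Bool) : 0 < bitLaw b c := by
  refine lt_of_le_of_ne (bitLaw_nonneg hb c) fun h0 => ?_
  have h1 := sum_negMulLog_bitLaw hb hent
  have h2 : 0 < Real.log 2 / k := div_pos (Real.log_pos one_lt_two) hk
  have h3 := bitLaw_add b
  rw [Fintype.sum_bool] at h1
  cases c
  · rw [← h0, add_zero] at h3
    rw [← h0, h3] at h1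
    simp at h1
    linarith
  · rw [← h0, zero_add] at h3
    rw [← h0, h3] at h1
    simp at h1
    linarith

include hent in
/-- A bit of large entropy is not too biased. -/
lemma sq_entropy_le_mul : (Real.log 2 / k) ^ 2 ≤ 18 * (bitLaw b true * bitLaw b false) := by
  have key : ∀ x y : ℝ, 0 ≤ x → x + y = 1 → x ≤ y →
      (Real.negMulLog x + Real.negMulLog y) ^ 2 ≤ 18 * (x * y) := by
    intro x y hx hxy hle
    have h1 := negMulLog_le_two_sqrt hx
    have h2 := negMulLog_le_one_sub (x := y) (by linarith)
    have h3 := Real.negMulLog_nonneg hx (by linarith)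
    have h4 := Real.negMulLog_nonneg (x := y) (by linarith) (by linarith)
    have h5 : x ≤ Real.sqrt x := Real.le_sqrt_of_sq_le (by nlinarith)
    have h6 : Real.negMulLog x + Real.negMulLog y ≤ 3 * Real.sqrt x := by linarith
    calc _ ≤ (3 * Real.sqrt x) ^ 2 := pow_le_pow_left₀ (by linarith) h6 2
      _ = 9 * x := by rw [mul_pow, Real.sq_sqrt hx]; norm_num
      _ ≤ _ := by nlinarith
  rw [← sum_negMulLog_bitLaw hb hent, Fintype.sum_bool]
  rcases le_total (bitLaw b true) (bitLaw b false) with h | h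
  · exact key _ _ (bitLaw_nonneg hb _) (bitLaw_add b) h
  · rw [add_comm, mul_comm (bitLaw b true)]
    exact key _ _ (bitLaw_nonneg hb _) (by rw [add_comm]; exact bitLaw_add b) h

include hent in
lemma sum_bitLaw_mul_centred :
    ∑ c, bitLaw b c * (-Real.log (bitLaw b c) - Real.log 2 / k) = 0 := by
  have h := sum_negMulLog_bitLaw hb hent
  have h2 := bitLaw_add b
  simp only [Fintype.sum_bool, Real.negMulLog] at h ⊢
  linear_combination h - (Real.log 2 / k) * h2

include hent in
lemma sum_bitLaw_mul_centred_sq :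
    ∑ c, bitLaw b c * (-Real.log (bitLaw b c) - Real.log 2 / k) ^ 2 ≤ 8 := by
  have h := sum_bitLaw_mul_centred hb hent
  have h2 := bitLaw_add b
  have ht := bitLaw_nonneg hb true
  have hf := bitLaw_nonneg hb false
  have h3 := mul_neg_log_sq_le ht (by linarith)
  have h4 := mul_neg_log_sq_le hf (by linarith)
  simp only [Fintype.sum_bool] at h ⊢
  -- The variance is at most the second moment.
  set e := Real.log 2 / k
  have h5 : bitLaw b true * (-Real.log (bitLaw b true) - e) ^ 2 +
      bitLaw b false * (-Real.log (bitLaw b false) - e) ^ 2 =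
      bitLaw b true * (-Real.log (bitLaw b true)) ^ 2 +
        bitLaw b false * (-Real.log (bitLaw b false)) ^ 2 - e ^ 2 := by
    linear_combination (-2 * e) * h - e ^ 2 * h2
  linarith [sq_nonneg e]

end Entropy

/-! ### The statistical test -/

section Test

variable {N : ℕ}

/-- The vertex bits of an output string. -/
def vertexBits (y : Fin (N + 1) → Bool) (i : Fin (N / 2)) : Bool := y ⟨i, by omega⟩

/-- The edge bits of an output string. -/
def edgeBits (y : Fin (N + 1) → Bool) (i : Fin (N / 2)) : Bool := y ⟨N / 2 + i, by omega⟩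

lemma pmMajMod_init (p : ℕ) (y : Fin (N + 1) → Bool) : pmMajMod p (Fin.init y) =
    xor (majMod p (signedSum (vertexBits y) (edgeBits y))) (bitParity (vertexBits y)) := rfl

lemma bitSign_pmMajMod (p : ℕ) (y : Fin (N + 1) → Bool) : bitSign (pmMajMod p (Fin.init y)) =
    bitSign (majMod p (signedSum (vertexBits y) (edgeBits y))) *
      (-1) ^ signedSum (vertexBits y) (edgeBits y) := by
  rw [pmMajMod_init, bitSign_xor, bitParity_eq _ (edgeBits y), bitSign_odd]

/-- A string is determined by its vertex bits and edge bits, and its last bit. -/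
lemma ext_of_vertexBits_edgeBits (hN : Even N) {y y' : Fin (N + 1) → Bool}
    (hv : vertexBits y = vertexBits y') (he : edgeBits y = edgeBits y')
    (hl : y (Fin.last N) = y' (Fin.last N)) : y = y' := by
  obtain ⟨m, hm⟩ := hN
  funext j
  rcases lt_or_ge (j : ℕ) (N / 2) with h | h
  · exact congrFun hv ⟨j, h⟩
  rcases lt_or_ge (j : ℕ) N with h' | h'
  · have := congrFun he ⟨(j : ℕ) - N / 2, by omega⟩
    unfold edgeBits at this
    have hj : (⟨N / 2 + ((j : ℕ) - N / 2), by omega⟩ : Fin (N + 1)) = j := Fin.ext (by simp; omega)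
    simpa only [hj] using this
  · have hj : j = Fin.last N := Fin.ext (by simp; omega)
    rw [hj, hl]

/-- The strings in which fewer than `|A| * ρ / 2` of the sets `V a` carry the extremal pattern of set
vertex bits and even path parities, where `ρ` is to bound the probability of each pattern from below. -/
def fewPatterns {ι : Type*} (A : Finset ι) (V : ι → Finset (Fin (N / 2))) (ρ : ℝ) :
    Set (Fin (N + 1) → Bool) :=
  {y | ((A.filter fun a => ∀ i ∈ V a, vertexBits y i = true ∧
    pathParity (edgeBits y) i = false).card : ℝ) < A.card * ρ / 2}

/-- The strings whose last bit is not the function of the others that it should be. -/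
def wrongLast (p N : ℕ) : Set (Fin (N + 1) → Bool) :=
  {y | y (Fin.last N) ≠ pmMajMod p (Fin.init y)}

lemma targetDist_wrongLast (p N : ℕ) : (targetDist p N).real (wrongLast p N) = 0 := by
  classical
  rw [targetDist_real]
  have : ∀ z : Fin N → Bool,
      (Fin.snoc z (pmMajMod p z) : Fin (N + 1) → Bool) ∉ wrongLast p N := by
    intro z
    simp [wrongLast]
  simp [this, expect]

/-- Since path parities determine the edge bits, the vertex bits and path parities of a uniform
string are independent uniform bits. -/
lemma targetDist_fewPatterns_le (hN : Even N) (p : ℕ) {ι : Type*} [DecidableEq ι] {A : Finset ι}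
    {V : ι → Finset (Fin (N / 2))} (hA : A.Nonempty)
    (hV : ∀ a ∈ A, ∀ b ∈ A, a ≠ b → Disjoint (V a) (V b)) {ρ : ℝ} (hρ : 0 < ρ)
    (hVρ : ∀ a ∈ A, ρ ≤ (1 / 4) ^ (V a).card) :
    (targetDist p N).real (fewPatterns A V ρ) ≤ 4 / (A.card * ρ) := by
  classical
  rw [targetDist_real]
  set t : (Fin N → Bool) → Fin (N + 1) → Bool := fun z => Fin.snoc z (pmMajMod p z) with ht
  set Ψ : (Fin N → Bool) → (Fin (N / 2) ⊕ Fin (N / 2)) → Bool := fun z =>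
    Sum.elim (vertexBits (t z)) (pathParity (edgeBits (t z))) with hΨ
  set pat : (Fin (N / 2) ⊕ Fin (N / 2)) → Bool := Sum.elim (fun _ => true) (fun _ => false) with hpat
  have hinit : ∀ z, Fin.init (t z) = z := fun z => by rw [ht]; exact Fin.init_snoc _ _
  have hinj : Function.Injective Ψ := by
    intro z z' h
    have hv : vertexBits (t z) = vertexBits (t z') := funext fun i => congrFun h (Sum.inl i)
    have he : edgeBits (t z) = edgeBits (t z') :=
      pathParity_injective (funext fun i => congrFun h (Sum.inr i))
    have hpm : pmMajMod p z = pmMajMod p z' := by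
      rw [← hinit z, ← hinit z', pmMajMod_init, pmMajMod_init, hv, he]
    have : t z = t z' := ext_of_vertexBits_edgeBits hN hv he (by simpa [ht] using hpm)
    rw [← hinit z, ← hinit z', this]
  have h := expect_few_patterns_le (w := fun _ => (1 / 2 : ℝ)) (fun _ => by norm_num) (by norm_num) A
    (fun a => (V a).disjSum (V a)) (fun a ha b hb hab => ?_) pat hρ hA (fun a ha => ?_)
  · refine le_trans ?_ h
    unfold expect
    have hw : ∀ z, prodWeight (fun _ => (1 / 2 : ℝ)) z = prodWeight (fun _ => (1 / 2 : ℝ)) (Ψ z) := by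
      intro z
      obtain ⟨m, hm⟩ := hN
      simp only [prodWeight, Finset.prod_const, Finset.card_univ, Fintype.card_sum, Fintype.card_fin]
      congr 1
      omega
    have hev : ∀ z, t z ∈ fewPatterns A V ρ ↔
        ((A.filter fun a => ∀ i ∈ (V a).disjSum (V a), Ψ z i = pat i).card : ℝ) <
          A.card * ρ / 2 := by
      intro z
      have : ∀ a, (∀ i ∈ V a, vertexBits (t z) i = true ∧ pathParity (edgeBits (t z)) i = false) ↔
          ∀ i ∈ (V a).disjSum (V a), Ψ z i = pat i := by
        intro a
        simp [hΨ, hpat, Sum.forall, forall_and]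
      rw [← Finset.filter_congr fun a _ => this a]
      rfl
    set φ : ((Fin (N / 2) ⊕ Fin (N / 2)) → Bool) → ℝ := fun u =>
      prodWeight (fun _ => (1 / 2 : ℝ)) u •
        if ((A.filter fun a => ∀ i ∈ (V a).disjSum (V a), u i = pat i).card : ℝ) <
          A.card * ρ / 2 then (1 : ℝ) else 0 with hφ
    have hsum : ∑ z, prodWeight (fun _ => (1 / 2 : ℝ)) z •
        (if t z ∈ fewPatterns A V ρ then (1 : ℝ) else 0) = ∑ z, φ (Ψ z) :=
      Finset.sum_congr rfl fun z _ => by rw [hw z, if_congr (hev z) rfl rfl]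
    refine hsum.le.trans ?_
    rw [← Finset.sum_image (s := Finset.univ) (g := Ψ) (f := φ) fun _ _ _ _ h => hinj h]
    refine Finset.sum_le_sum_of_subset_of_nonneg (Finset.subset_univ _) fun u _ _ => ?_
    refine smul_nonneg (prodWeight_nonneg (fun _ => by norm_num) u) ?_
    split_ifs <;> norm_num
  · rw [Finset.disjoint_left]
    have hd := Finset.disjoint_left.mp (hV a ha b hb hab)
    rintro (i | i) hi hi' <;> simp only [Finset.inl_mem_disjSum, Finset.inr_mem_disjSum] at hi hi' <;>
      exact hd hi hi'
  · rw [Finset.prod_const, Finset.card_disjSum, ← two_mul, pow_mul]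
    norm_num
    simpa using hVρ a ha

/-- The strings that `f` outputs with probability at least `exp (-τ)`. There are at most `exp τ` of
them. -/
def heavy {ℓ : ℕ} (w : Bool → ℝ) (f : (Fin ℓ → Bool) → Fin (N + 1) → Bool) (τ : ℝ) :
    Set (Fin (N + 1) → Bool) :=
  {y | Real.exp (-τ) ≤ expect w fun u => if f u = y then (1 : ℝ) else 0}

lemma targetDist_heavy_le (p : ℕ) {ℓ : ℕ} {w : Bool → ℝ} (hw0 : ∀ c, 0 ≤ w c)
    (hw : w true + w false = 1) (f : (Fin ℓ → Bool) → Fin (N + 1) → Bool) (τ : ℝ) :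
    (targetDist p N).real (heavy w f τ) ≤ Real.exp (τ - N * Real.log 2) := by
  classical
  rw [targetDist_real]
  set t : (Fin N → Bool) → Fin (N + 1) → Bool := fun z => Fin.snoc z (pmMajMod p z) with ht
  have hinj : Function.Injective t := by
    intro z z' h
    have h2 := congrArg Fin.init h
    simpa [ht] using h2
  set q : (Fin (N + 1) → Bool) → ℝ := fun y => expect w fun u => if f u = y then (1 : ℝ) else 0
  have h1 : ∀ z, (if t z ∈ heavy w f τ then (1 : ℝ) else 0) ≤ Real.exp τ * q (t z) := by
    intro z
    split_ifs with h
    · have h2 : Real.exp (-τ) ≤ q (t z) := h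
      calc (1 : ℝ) = Real.exp τ * Real.exp (-τ) := by rw [← Real.exp_add]; simp
        _ ≤ _ := by gcongr
    · refine mul_nonneg (Real.exp_pos _).le (Finset.sum_nonneg fun u _ => ?_)
      refine smul_nonneg (prodWeight_nonneg hw0 u) ?_
      dsimp only
      split_ifs <;> norm_num
  have h2 : ∑ z, q (t z) ≤ 1 := by
    simp only [q]
    rw [← expect_sum]
    refine le_trans (expect_mono hw0 (h := fun _ => 1) fun u => ?_) (expect_const hw 1).le
    rw [← Finset.sum_filter, Finset.sum_const, nsmul_eq_mul, mul_one]
    have : (Finset.univ.filter fun z => f u = t z).card ≤ 1 :=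
      Finset.card_le_one.mpr fun z hz z' hz' => hinj (by
        rw [← (Finset.mem_filter.mp hz).2, ← (Finset.mem_filter.mp hz').2])
    exact_mod_cast this
  calc (expect (fun _ => 1 / 2) fun z => if t z ∈ heavy w f τ then (1 : ℝ) else 0)
      ≤ expect (fun _ => 1 / 2) fun z => Real.exp τ * q (t z) :=
        expect_mono (fun _ => by norm_num) h1
    _ = (1 / 2) ^ N * Real.exp τ * ∑ z, q (t z) := by
        unfold expect
        rw [Finset.mul_sum]
        refine Finset.sum_congr rfl fun z _ => ?_
        simp [prodWeight]
        ring
    _ ≤ (1 / 2) ^ N * Real.exp τ * 1 := by gcongr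
    _ = Real.exp (τ - N * Real.log 2) := by
        rw [mul_one, Real.exp_sub, mul_comm (N : ℝ), Real.exp_mul, Real.exp_log two_pos,
          Real.rpow_natCast]
        rw [one_div, inv_pow]
        field_simp

end Test

/-! ### The test applied to a local sampler -/

section Source

variable {N ℓ : ℕ} {f : (Fin ℓ → Bool) → Fin (N + 1) → Bool}
  {Wv : Fin (N / 2) → Finset (Fin ℓ)} {Wl : Finset (Fin ℓ)} {top : Finset (Fin (N / 2))}
  {V : Fin ℓ → Finset (Fin (N / 2))} {A : Finset (Fin ℓ)} (H : Isolated Wv Wl top V A)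
  (hx : ∀ i, DependsOn (fun u => vertexBits (f u) i) (Wv i : Set (Fin ℓ)))
  (hd : ∀ i, DependsOn (fun u => edgeBits (f u) i) (Wv i : Set (Fin ℓ)))
  (hl : DependsOn (fun u => f u (Fin.last N)) (Wl : Set (Fin ℓ)))

/-- The isolated inputs that do not influence the output of `f`. -/
def inert (f : (Fin ℓ → Bool) → Fin (N + 1) → Bool) (V : Fin ℓ → Finset (Fin (N / 2)))
    (A : Finset (Fin ℓ)) (u : Fin ℓ → Bool) : Finset (Fin ℓ) :=
  inertInputs (fun u => vertexBits (f u)) (fun u => edgeBits (f u)) V A u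

include H hx hd hl in
/-- The inputs outside the inert ones determine the output, so it is at least as likely as
they are. -/
lemma prod_le_expect_eq (hN : Even N) {w : Bool → ℝ} (hw0 : ∀ c, 0 ≤ w c)
    (hw : w true + w false = 1) (u : Fin ℓ → Bool) :
    ∏ i ∈ Finset.univ \ inert f V A u, w (u i) ≤
      expect w fun v => if f v = f u then (1 : ℝ) else 0 := by
  rw [← expect_cylinder hw]
  refine expect_mono hw0 fun v => ?_
  split_ifs with h1 h2
  · exact le_rfl
  · refine absurd ?_ h2
    have h3 : ∀ k ∉ inert f V A u, v k = u k := fun k hk => h1 k (by simpa using hk)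
    have h4 := fun a (ha : a ∈ inert f V A u) => (Finset.mem_filter.mp ha).2
    refine ext_of_vertexBits_edgeBits hN
      (eq_of_eqOn_compl_inertInputs H (y := fun u => vertexBits (f u)) h3 hx
        fun a ha i hi => (h4 a ha i hi).1)
      (eq_of_eqOn_compl_inertInputs H (y := fun u => edgeBits (f u)) h3 hd
        fun a ha i hi => (h4 a ha i hi).2)
      (hl fun k hk => h3 k fun hkF => ?_)
    exact H.notMem_last k (Finset.mem_filter.mp hkF).1 hk
  · exact zero_le_one
  · exact le_rfl

include hx hd in
/-- Isolated inputs without influence are inert. -/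
lemma compl_inert_subset (hA : ∀ a, a ∉ Finset.univ.biUnion Wv ∪ Wl → a ∈ A) (u : Fin ℓ → Bool) :
    Finset.univ \ inert f V A u ⊆ Finset.univ.biUnion Wv ∪ Wl := by
  intro i hi
  by_contra hiW
  refine (Finset.mem_sdiff.mp hi).2 (Finset.mem_filter.mpr ⟨hA i hiW, fun j _ => ?_⟩)
  have hij : i ∉ Wv j := fun hij => hiW
    (Finset.mem_union_left _ (Finset.mem_biUnion.mpr ⟨j, Finset.mem_univ j, hij⟩))
  exact ⟨(DependsOn.update_eq (hx j) hij u true).trans (DependsOn.update_eq (hx j) hij u false).symm,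
    (DependsOn.update_eq (hd j) hij u true).trans (DependsOn.update_eq (hd j) hij u false).symm⟩

include H hx hd hl in
open scoped Classical in
/-- If so many inputs are inert that the expected information of the others stays below `τ` nats by
a margin `lam`, then the output is heavy unless the information deviates by `lam` from its
expectation; this is unlikely since only the inputs that some output reads contribute to the
variance. -/
lemma expect_notMem_heavy_le (hN : Even N) {b k : ℝ} (hb : |b| ≤ 1 / 2) (hk : 0 < k)
    (hent : bitEntropy (biasedBit b hb) = 1 / k)
    (hA : ∀ a, a ∉ Finset.univ.biUnion Wv ∪ Wl → a ∈ A) {τ lam : ℝ} (hlam : 0 < lam) :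
    (expect (bitLaw b) fun u =>
      if Real.log 2 / k * (Finset.univ \ inert f V A u).card + lam ≤ τ ∧
        f u ∉ heavy (bitLaw b) f τ then (1 : ℝ) else 0) ≤
      (Finset.univ.biUnion Wv ∪ Wl).card * 8 / lam ^ 2 := by
  set h := Real.log 2 / k with hh
  have hw0 := bitLaw_nonneg hb
  have hpos := bitLaw_pos hb hk hent
  refine expect_indicator_le hw0
    (Z := fun u => ∑ i ∈ Finset.univ \ inert f V A u, (-Real.log (bitLaw b (u i)) - h)) hlam
    (expect_sq_sum_le hw0 (bitLaw_add b) (ξ := fun c => -Real.log (bitLaw b c) - h)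
      (sum_bitLaw_mul_centred hb hent) (sum_bitLaw_mul_centred_sq hb hent) A _ _ ?_ ?_ ?_) _ ?_
  · intro a ha u c
    have := inertInputs_update H hx hd ha u c
    unfold inert
    rw [this]
  · intro u i hi
    simp only [Finset.mem_sdiff, Finset.mem_univ, true_and]
    exact fun hF => hi (Finset.mem_filter.mp hF).1
  · exact compl_inert_subset hx hd hA
  · rintro u ⟨h1, h2⟩
    have h3 : ∏ i ∈ Finset.univ \ inert f V A u, bitLaw b (u i) < Real.exp (-τ) :=
      lt_of_le_of_lt (prod_le_expect_eq H hx hd hl hN hw0 (bitLaw_add b) u) (not_le.mp h2)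
    have h4 := Real.log_lt_log (Finset.prod_pos fun i _ => hpos _) h3
    rw [Real.log_exp, Real.log_prod fun i _ => (hpos _).ne'] at h4
    refine le_trans ?_ (le_abs_self _)
    rw [Finset.sum_sub_distrib, Finset.sum_neg_distrib, Finset.sum_const, nsmul_eq_mul]
    linarith

include H hx hd hl in
/-- The lower bound on the distance, in terms of a family of isolated inputs. The dichotomy `hY`
says that the inputs that are not inert carry too little information, or few inputs are
inert. In the latter case the output has too few extremal patterns, or many inputs are active and
the last bit is wrong about half of the time. -/
theorem le_tvDistance_of_isolated {p : ℕ} [Fact p.Prime] (hp : p ≠ 2) (hN : Even N) {b k : ℝ}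
    (hb : |b| ≤ 1 / 2) (hk : 0 < k) (hent : bitEntropy (biasedBit b hb) = 1 / k)
    (hA : ∀ a, a ∉ Finset.univ.biUnion Wv ∪ Wl → a ∈ A) (hAne : A.Nonempty) {ρ : ℝ} (hρ : 0 < ρ)
    (hVρ : ∀ a ∈ A, ρ ≤ (1 / 4) ^ (V a).card) (hVp : ∀ a ∈ A, 2 * (V a).card < p) {lam r : ℝ}
    (hlam : 0 < lam) (hr : 0 ≤ r)
    (hY : ∀ u, N * Real.log 2 < Real.log 2 / k * (Finset.univ \ inert f V A u).card + 2 * lam →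
      ((inert f V A u).card : ℝ) < A.card * ρ / 4 ∧
      Real.exp (-(bitLaw b true * bitLaw b false / (2 * p ^ 2)) * (A.card * ρ / 4)) ≤ r) :
    1 / 2 - (1 / p + p * r) / 2 - (Finset.univ.biUnion Wv ∪ Wl).card * 8 / lam ^ 2 -
        Real.exp (-lam) - 4 / (A.card * ρ) ≤
      tvDistance ((biasedBits b hb ℓ).map f) (targetDist p N) := by
  classical
  set w := bitLaw b with hw
  have hw0 : ∀ c, 0 ≤ w c := bitLaw_nonneg hb
  have hw1 : w true + w false = 1 := bitLaw_add b
  set x : (Fin ℓ → Bool) → Fin (N / 2) → Bool := fun u => vertexBits (f u) with hxdef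
  set d : (Fin ℓ → Bool) → Fin (N / 2) → Bool := fun u => edgeBits (f u) with hddef
  set τ : ℝ := N * Real.log 2 - lam with hτ
  set T := (heavy w f τ ∪ fewPatterns A V ρ) ∪ wrongLast p N with hT
  have hmeas : Measurable f := measurable_of_countable f
  have : IsProbabilityMeasure ((biasedBits b hb ℓ).map f) :=
    Measure.isProbabilityMeasure_map hmeas.aemeasurable
  have : IsProbabilityMeasure (targetDist p N) :=
    Measure.isProbabilityMeasure_map (measurable_of_countable _).aemeasurable
  refine le_trans ?_ (le_tvDistance _ _ T)
  have htarget : (targetDist p N).real T ≤ Real.exp (-lam) + 4 / (A.card * ρ) := by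
    have h1 := targetDist_heavy_le (N := N) p hw0 hw1 f τ
    have h2 := targetDist_fewPatterns_le hN p hAne H.disj hρ hVρ
    have h3 := targetDist_wrongLast p N
    have h4 : τ - N * Real.log 2 = -lam := by rw [hτ]; ring
    rw [h4] at h1
    have h5 := measureReal_union_le (μ := targetDist p N) (heavy w f τ ∪ fewPatterns A V ρ)
      (wrongLast p N)
    have h6 := measureReal_union_le (μ := targetDist p N) (heavy w f τ) (fewPatterns A V ρ)
    linarith
  -- The three cases for the inputs outside `A`.
  set Y1 : (Fin ℓ → Bool) → Prop := fun u =>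
    Real.log 2 / k * (Finset.univ \ inert f V A u).card + lam ≤ τ with hY1
  set Y2 : (Fin ℓ → Bool) → Prop := fun u =>
    ¬ Y1 u ∧ A.card * ρ / 4 ≤ ((activeInputs x d V A u).card : ℝ) with hY2
  set G : (Fin ℓ → Bool) → ℂ := fun u =>
    (if Y2 u then 1 else 0) * bitSign (f u (Fin.last N)) with hG
  set χ : (Fin ℓ → Bool) → ℂ := fun u =>
    G u * (bitSign (majMod p (signedSum (x u) (d u))) * (-1) ^ signedSum (x u) (d u)) with hχ
  have hY' : ∀ u, ¬ Y1 u → ((inert f V A u).card : ℝ) < A.card * ρ / 4 ∧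
      Real.exp (-(w true * w false / (2 * p ^ 2)) * (A.card * ρ / 4)) ≤ r := by
    intro u hu
    refine hY u ?_
    rw [hY1] at hu
    push Not at hu
    rw [hτ] at hu
    linarith
  have hbias : ‖expect w χ‖ ≤ 1 / p + p * r := by
    refine norm_expect_bitSign_le hp hw0 hw1 H hx hd hVp (fun u => ?_) (fun a ha u c => ?_) hr
      fun u hu => ?_
    · rw [hG, norm_mul, norm_bitSign, mul_one]
      split_ifs <;> simp
    · have h1 : inert f V A (Function.update u a c) = inert f V A u :=
        inertInputs_update H hx hd ha u c
      have h2 : activeInputs x d V A (Function.update u a c) = activeInputs x d V A u :=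
        activeInputs_update H hx hd ha u c
      have h3 : f (Function.update u a c) (Fin.last N) = f u (Fin.last N) :=
        DependsOn.update_eq hl (H.notMem_last a ha) u c
      simp only [hG, hY2, hY1, h1, h2, h3]
    · have hu2 : Y2 u := by
        by_contra h
        exact hu (by simp [hG, h])
      refine le_trans (Real.exp_le_exp.mpr ?_) (hY' u hu2.1).2
      refine mul_le_mul_of_nonpos_left hu2.2 (neg_nonpos.mpr ?_)
      exact div_nonneg (mul_nonneg (hw0 _) (hw0 _)) (by positivity)
  have hsource : 1 - (1 / p + p * r) -
      2 * ((Finset.univ.biUnion Wv ∪ Wl).card * 8 / lam ^ 2) ≤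
        2 * ((biasedBits b hb ℓ).map f).real T := by
    have hheavy : (expect w fun u => if Y1 u ∧ f u ∉ heavy w f τ then (1 : ℝ) else 0) ≤
        (Finset.univ.biUnion Wv ∪ Wl).card * 8 / lam ^ 2 := by
      convert expect_notMem_heavy_le H hx hd hl hN hb hk hent hA (τ := τ) hlam
    have hmap : ((biasedBits b hb ℓ).map f).real T =
        expect w fun u => if f u ∈ T then (1 : ℝ) else 0 := by
      convert map_biasedBits_real b hb f T
    rw [hmap]
    have hre : expect w (fun u => (χ u).re) = (expect w χ).re := by
      unfold expect
      rw [Complex.re_sum]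
      simp
    have hre2 := (Complex.re_le_norm (expect w χ)).trans hbias
    -- Outside the exceptional event, the test accepts always in two cases, and in the remaining one
    -- exactly if the last bit has the wrong sign, that is, if `χ u = -1`.
    have key : ∀ u, (1 - (χ u).re) - 2 * (if Y1 u ∧ f u ∉ heavy w f τ then (1 : ℝ) else 0) ≤
        2 * (if f u ∈ T then (1 : ℝ) else 0) := by
      intro u
      by_cases h1 : Y1 u
      · have hχ0 : χ u = 0 := by simp [hχ, hG, hY2, h1]
        by_cases h2 : f u ∈ heavy w f τ
        · have hTu : f u ∈ T := Or.inl (Or.inl h2)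
          simp [hχ0, h2, hTu]
        · rw [hχ0, if_pos ⟨h1, h2⟩]
          split_ifs <;> norm_num
      · rw [if_neg fun h => h1 h.1]
        by_cases h2 : Y2 u
        · have hχu : χ u = bitSign (f u (Fin.last N)) * bitSign (pmMajMod p (Fin.init (f u))) := by
            rw [bitSign_pmMajMod]
            simp [hχ, hG, h2, hxdef, hddef]
          by_cases h3 : f u (Fin.last N) = pmMajMod p (Fin.init (f u))
          · have : χ u = 1 := by
              rw [hχu, h3, bitSign_mul_self]
            rw [this]
            split_ifs <;> norm_num
          · have hTu : f u ∈ T := Or.inr h3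
            have : χ u = -1 := by
              rw [hχu, bitSign_mul_of_ne h3]
            rw [this, if_pos hTu]
            norm_num
        · have hχ0 : χ u = 0 := by simp [hχ, hG, h2]
          -- Inputs whose part shows the extremal pattern are inert or active.
          have hTu : f u ∈ T := by
            refine Or.inl (Or.inr ?_)
            have hact : ((activeInputs x d V A u).card : ℝ) < A.card * ρ / 4 := by
              by_contra h
              exact h2 ⟨h1, not_lt.mp h⟩
            have hsub : (A.filter fun a => ∀ i ∈ V a, vertexBits (f u) i = true ∧
                pathParity (edgeBits (f u)) i = false) ⊆
                inert f V A u ∪ activeInputs x d V A u := by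
              intro a ha
              obtain ⟨haA, hpat⟩ := Finset.mem_filter.mp ha
              by_cases haF : a ∈ inert f V A u
              · exact Finset.mem_union_left _ haF
              · exact Finset.mem_union_right _ (mem_activeInputs H hd haA haF hpat)
            have hc : ((A.filter fun a => ∀ i ∈ V a, vertexBits (f u) i = true ∧
                pathParity (edgeBits (f u)) i = false).card : ℝ) ≤
                (inert f V A u).card + (activeInputs x d V A u).card := by
              exact_mod_cast (Finset.card_le_card hsub).trans (Finset.card_union_le _ _)
            have := (hY' u h1).1
            change ((A.filter fun a => ∀ i ∈ V a, vertexBits (f u) i = true ∧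
                pathParity (edgeBits (f u)) i = false).card : ℝ) < A.card * ρ / 2
            linarith
          rw [hχ0, if_pos hTu]
          norm_num
    have h := expect_mono hw0 key
    rw [expect_sub, expect_sub, expect_mul_left, expect_mul_left, expect_const hw1, hre] at h
    linarith
  linarith

end Source

/-! ### Choice of the parameters -/

section Parameters

/-- A sampler with fewer input bits than the entropy of its target misses half of the target. -/
lemma half_le_tvDistance_of_lt {b : ℝ} (hb : |b| ≤ 1 / 2) {ℓ N : ℕ} (hℓ : ℓ < N) (p : ℕ)
    (f : (Fin ℓ → Bool) → Fin (N + 1) → Bool) :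
    1 / 2 ≤ tvDistance ((biasedBits b hb ℓ).map f) (targetDist p N) := by
  classical
  have : IsProbabilityMeasure ((biasedBits b hb ℓ).map f) :=
    Measure.isProbabilityMeasure_map (measurable_of_countable f).aemeasurable
  have : IsProbabilityMeasure (targetDist p N) :=
    Measure.isProbabilityMeasure_map (measurable_of_countable _).aemeasurable
  refine le_trans ?_ (le_tvDistance _ _ (Set.range f))
  have h1 : ((biasedBits b hb ℓ).map f).real (Set.range f) = 1 := by
    rw [map_biasedBits_real]
    simp [expect_const (bitLaw_add b)]
  have h2 : (targetDist p N).real (Set.range f) ≤ 1 / 2 := by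
    rw [targetDist_real]
    set t : (Fin N → Bool) → Fin (N + 1) → Bool := fun z => Fin.snoc z (pmMajMod p z) with ht
    have hinj : Function.Injective t := by
      intro z z' h
      have h2 := congrArg Fin.init h
      simpa [ht] using h2
    have hcard : (Finset.univ.filter fun z => t z ∈ Set.range f).card ≤ 2 ^ ℓ := by
      calc (Finset.univ.filter fun z => t z ∈ Set.range f).card
          ≤ (Finset.univ.image f).card := by
            refine Finset.card_le_card_of_injOn t (fun z hz => ?_) fun z _ z' _ h => hinj h
            simpa using hz
        _ ≤ (Finset.univ : Finset (Fin ℓ → Bool)).card := Finset.card_image_le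
        _ = 2 ^ ℓ := by simp
    have hsum : (expect (fun _ => 1 / 2) fun z => if t z ∈ Set.range f then (1 : ℝ) else 0) =
        (1 / 2) ^ N * (Finset.univ.filter fun z => t z ∈ Set.range f).card := by
      unfold expect
      simp only [prodWeight, Finset.prod_const, Finset.card_univ, Fintype.card_fin, smul_eq_mul]
      rw [← Finset.mul_sum, Finset.sum_ite, Finset.sum_const_zero, add_zero, Finset.sum_const,
        nsmul_eq_mul, mul_one]
    refine le_trans (le_of_eq ?_) (hsum.le.trans ?_)
    · congr!
    obtain ⟨j, rfl⟩ := Nat.exists_eq_add_of_lt hℓ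
    calc (1 / 2 : ℝ) ^ (ℓ + j + 1) * (Finset.univ.filter fun z => t z ∈ Set.range f).card
        ≤ (1 / 2 : ℝ) ^ (ℓ + j + 1) * 2 ^ ℓ := by
          gcongr
          exact_mod_cast hcard
      _ = (1 / 2) ^ (j + 1) := by
          rw [add_assoc, pow_add, one_div, inv_pow (2 : ℝ) ℓ]
          field_simp
      _ ≤ (1 / 2) ^ 1 := pow_le_pow_of_le_one (by norm_num) (by norm_num) (by omega)
      _ = 1 / 2 := pow_one _
  linarith

lemma eventually_mul_log_pow_le (C : ℝ) (n : ℕ) {r : ℝ} (hr : 0 < r) :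
    ∀ᶠ N : ℕ in Filter.atTop, C * Real.log N ^ n ≤ (N : ℝ) ^ r := by
  have h := (isLittleO_log_rpow_rpow_atTop (n : ℝ) hr).const_mul_left C
  filter_upwards [tendsto_natCast_atTop_atTop.eventually (h.bound one_pos),
    Filter.eventually_ge_atTop 1] with N hN h1
  rw [one_mul, Real.norm_of_nonneg (by positivity : (0 : ℝ) ≤ (N : ℝ) ^ r), Real.rpow_natCast] at hN
  exact (le_abs_self _).trans hN

/-- If the bits that are not inert carry all the information, each of them carries much, as there
are only few, and few bits are inert. Here `h` is the entropy of a bit in nats, and `F` and `R` count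
the inert bits and the others. -/
lemma few_inert_of_information {x L Q lam h k F R l : ℝ} (hx : 0 < x) (hL : 1 ≤ L) (hlam : 0 < lam)
    (hlamx : 20 * lam ≤ x) (hlamQ : 9 * L * lam ≤ Q) (hh : 0 < h) (hhk : h * k = Real.log 2)
    (hl : l ≤ k * x + lam) (hRF : R = l - F) (hR : R ≤ 2 * x * L)
    (hu : x * Real.log 2 < h * R + 2 * lam) : 1 ≤ 4 * L * h ∧ F < Q := by
  have hlog2 : 0.69 < Real.log 2 := lt_trans (by norm_num) Real.log_two_gt_d9
  have h1 : 1 ≤ 4 * L * h := by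
    have h2 := mul_le_mul_of_nonneg_left hR hh.le
    have h3 : x * 0.69 ≤ x * Real.log 2 := mul_le_mul_of_nonneg_left hlog2.le hx.le
    have h4 : x * 1 ≤ x * (4 * L * h) := by linarith
    exact le_of_mul_le_mul_left h4 hx
  refine ⟨h1, ?_⟩
  have h2 : h * R ≤ x * Real.log 2 + h * lam - h * F := by
    rw [← hhk, hRF]
    have := mul_le_mul_of_nonneg_left hl hh.le
    linarith
  have h3 : 2 * lam * 1 ≤ 2 * lam * (4 * L * h) := mul_le_mul_of_nonneg_left h1 (by linarith)
  have h4 : h * F < h * (lam + 8 * L * lam) := by linarith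
  have h5 := lt_of_mul_lt_mul_left h4 hh.le
  have h6 : 1 * lam ≤ L * lam := mul_le_mul_of_nonneg_right hL hlam.le
  linarith

/-- The exponent in the bound for the characters is at least `x ^ (1 / 8)`, since `p ^ 2` is at most
of order `x ^ (2 / 3)` while `q` is at least `x ^ (7 / 8)`. -/
lemma rpow_le_mixing_exponent {x L q c p v : ℝ} (hx : 1 ≤ x) (hp : 0 < p)
    (hpx : p ≤ c * x ^ (1 / 3 : ℝ))
    (hLx : 576 * c ^ 2 * L ^ 2 ≤ x ^ (1 / 12 : ℝ)) (hv : 1 ≤ 288 * L ^ 2 * v)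
    (hq : x ^ (7 / 8 : ℝ) ≤ q) : x ^ (1 / 8 : ℝ) ≤ v / (2 * p ^ 2) * q := by
  have hx0 : 0 < x := by linarith
  have hv0 : 0 ≤ v := by
    by_contra! h
    have : 288 * L ^ 2 * v ≤ 0 := mul_nonpos_of_nonneg_of_nonpos (by positivity) h.le
    linarith
  have h1 : p ^ 2 * 576 * L ^ 2 * x ^ (1 / 8 : ℝ) ≤ q := by
    calc p ^ 2 * 576 * L ^ 2 * x ^ (1 / 8 : ℝ)
        ≤ (c * x ^ (1 / 3 : ℝ)) ^ 2 * 576 * L ^ 2 * x ^ (1 / 8 : ℝ) := by gcongr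
      _ = (576 * c ^ 2 * L ^ 2) * ((x ^ (1 / 3 : ℝ)) ^ 2 * x ^ (1 / 8 : ℝ)) := by ring
      _ ≤ x ^ (1 / 12 : ℝ) * ((x ^ (1 / 3 : ℝ)) ^ 2 * x ^ (1 / 8 : ℝ)) := by gcongr
      _ = x ^ (7 / 8 : ℝ) := by
          rw [← Real.rpow_natCast, ← Real.rpow_mul hx0.le, ← Real.rpow_add hx0,
            ← Real.rpow_add hx0]
          norm_num
      _ ≤ q := hq
  rw [div_mul_eq_mul_div, le_div_iff₀ (by positivity)]
  have h2 := mul_le_mul_of_nonneg_left h1 hv0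
  have h3 : x ^ (1 / 8 : ℝ) * (2 * p ^ 2) * 1 ≤ x ^ (1 / 8 : ℝ) * (2 * p ^ 2) * (288 * L ^ 2 * v) :=
    mul_le_mul_of_nonneg_left hv (by positivity)
  linarith

set_option maxHeartbeats 800000 in
/-- The lower bound for a local sampler, for `N` so large that powers of `log N` are
negligible against the relevant powers of `N`. The excess length is at most `N ^ (1 - 2 * γ)`, which
is also the deviation allowed for the information in the input; fewer than `N ^ (1 - γ)` inert inputs
count as few. -/
lemma le_tvDistance_of_large {N p ℓ D : ℕ} {γ c₁ c₂ α b k : ℝ} (hγ0 : 0 < γ) (hγ : γ ≤ 1 / 8)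
    (hα : α < 1 / 3) (hc₂ : 0 < c₂) (hN : Even N) (hpp : p.Prime)
    (hp₁ : c₁ * (N : ℝ) ^ α ≤ p) (hp₂ : (p : ℝ) ≤ c₂ * (N : ℝ) ^ α)
    (hb : |b| ≤ 1 / 2) (hk : 0 < k) (hent : bitEntropy (biasedBit b hb) = 1 / k)
    (hℓN : N ≤ ℓ) (hℓ : (ℓ : ℝ) ≤ k * N + (N : ℝ) ^ (1 - 2 * γ))
    (f : (Fin ℓ → Bool) → Fin (N + 1) → Bool)
    (hf : ∀ i, ∃ S : Finset (Fin ℓ), S.card ≤ D ∧ DependsOn (fun u => f u i) (S : Set (Fin ℓ)))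
    (hD1 : 1 ≤ D) (hD : 1024 * (D : ℝ) ^ 2 ≤ γ * Real.log N) (hDL : (D : ℝ) ≤ Real.log N)
    (hN1 : 40 * Real.log N ≤ N)
    (E1 : 4104 * Real.log N ^ 3 ≤ (N : ℝ) ^ (γ / 2)) (E2 : 16 * Real.log N ^ 2 ≤ (N : ℝ) ^ (1 / 2 : ℝ))
    (E3 : 9 * Real.log N ≤ (N : ℝ) ^ γ) (E4 : 20 * Real.log N ≤ (N : ℝ) ^ (2 * γ))
    (E5 : 515 * Real.log N ^ 2 < c₁ * (N : ℝ) ^ α)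
    (E6 : 576 * c₂ ^ 2 * Real.log N ^ 2 ≤ (N : ℝ) ^ (1 / 12 : ℝ))
    (E7 : c₂ * Real.log N ≤ (N : ℝ) ^ (1 / 2 : ℝ)) (E8 : Real.log N ≤ (N : ℝ) ^ (1 / 8 : ℝ)) :
    1 / 2 - 4 / Real.log N ≤ tvDistance ((biasedBits b hb ℓ).map f) (targetDist p N) := by
  have : Fact p.Prime := ⟨hpp⟩
  set L := Real.log N with hL
  have hD1' : (1 : ℝ) ≤ D := by exact_mod_cast hD1
  have hL1 : 1 ≤ L := hD1'.trans hDL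
  have hx40 : (40 : ℝ) ≤ N := by linarith
  have hx0 : (0 : ℝ) < N := by linarith
  have hx1 : (1 : ℝ) ≤ N := by linarith
  have hDm : 40 * D ≤ N := by
    have : (40 * D : ℝ) ≤ N := by linarith
    exact_mod_cast this
  have hp0 : (0 : ℝ) < p := by exact_mod_cast hpp.pos
  have hL2 : 1 ≤ L ^ 2 := one_le_pow₀ hL1
  have hLL2 : L ≤ L ^ 2 := le_self_pow₀ hL1 two_ne_zero
  have hp2 : p ≠ 2 := by
    rintro rfl
    push_cast at hp₁
    linarith
  -- The inputs on which the outputs depend.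
  choose S hSc hS using hf
  have hN' := hN
  obtain ⟨m, hm⟩ := hN'
  have hm2 : N / 2 = m := by omega
  set Wv : Fin (N / 2) → Finset (Fin ℓ) := fun i => S ⟨i, by omega⟩ ∪ S ⟨N / 2 + i, by omega⟩ with hWv
  set Wl := S (Fin.last N) with hWl
  have hWvc : ∀ i, (Wv i).card ≤ 2 * D := fun i =>
    (Finset.card_union_le _ _).trans (by have := hSc ⟨i, by omega⟩; have := hSc ⟨N / 2 + i, by omega⟩; omega)
  have hxdep : ∀ i, DependsOn (fun u => vertexBits (f u) i) (Wv i : Set (Fin ℓ)) := fun i =>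
    DependsOn.mono (by rw [hWv]; simp) (hS ⟨i, by omega⟩)
  have hddep : ∀ i, DependsOn (fun u => edgeBits (f u) i) (Wv i : Set (Fin ℓ)) := fun i =>
    DependsOn.mono (by rw [hWv]; simp) (hS ⟨N / 2 + i, by omega⟩)
  -- The height of the cut is chosen such that `8 * D ≤ 2 ^ J ≤ 16 * D`.
  set J := Nat.log 2 (8 * D) + 1 with hJ
  have hJ1 : 8 * D ≤ 2 ^ J := (Nat.lt_pow_succ_log_self one_lt_two _).le
  have hJ2 : 2 ^ J ≤ 16 * D := by
    have := Nat.pow_log_le_self 2 (x := 8 * D) (by omega)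
    rw [hJ, pow_succ]
    omega
  obtain ⟨top, V, A, H, hVc, hAc, hAW⟩ := exists_isolated Wv Wl (D := D) (J := J) hWvc (hSc _)
    (by omega) (by omega) (by omega) hJ1 (by simp only [Fintype.card_fin]; omega)
  have hB : 8 * D * 2 ^ (J + 1) ≤ 256 * D ^ 2 := by
    calc 8 * D * 2 ^ (J + 1) = 16 * D * 2 ^ J := by ring
      _ ≤ 16 * D * (16 * D) := Nat.mul_le_mul_left _ hJ2
      _ = 256 * D ^ 2 := by ring
  have hVc' : ∀ a ∈ A, (V a).card ≤ 256 * D ^ 2 := fun a ha => (hVc a ha).trans hB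
  have hWc : ((Finset.univ.biUnion Wv ∪ Wl).card : ℝ) ≤ 2 * N * D := by
    have h1 : (Finset.univ.biUnion Wv ∪ Wl).card ≤ (N / 2) * (2 * D) + D := by
      refine (Finset.card_union_le _ _).trans (add_le_add ?_ (hSc _))
      simpa using Finset.card_biUnion_le_card_mul Finset.univ Wv (2 * D) fun i _ => hWvc i
    have h2 : (N / 2) * (2 * D) + D ≤ 2 * N * D := by
      calc (N / 2) * (2 * D) + D = (2 * (N / 2) + 1) * D := by ring
        _ ≤ 2 * N * D := Nat.mul_le_mul_right _ (by omega)
    exact_mod_cast h1.trans h2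
  -- A pattern on `V a` has probability at least `4 ^ (-256 * D ^ 2)`.
  set ρ : ℝ := (N : ℝ) ^ (-(γ / 2)) with hρdef
  have hρ : 0 < ρ := Real.rpow_pos_of_pos hx0 _
  have hVρ : ∀ a ∈ A, ρ ≤ (1 / 4) ^ (V a).card := by
    intro a ha
    have h4 : (1 / 4 : ℝ) = Real.exp (-(2 * Real.log 2)) := by
      rw [Real.exp_neg, two_mul, Real.exp_add, Real.exp_log two_pos]
      norm_num
    rw [hρdef, Real.rpow_def_of_pos hx0, h4, ← Real.exp_nat_mul]
    refine Real.exp_le_exp.mpr ?_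
    have h5 : ((V a).card : ℝ) ≤ 256 * (D : ℝ) ^ 2 := by exact_mod_cast hVc' a ha
    have h6 : Real.log 2 ≤ 1 := Real.log_two_lt_d9.le.trans (by norm_num)
    have h7 : ((V a).card : ℝ) * (2 * Real.log 2) ≤ (V a).card * 2 := by
      refine mul_le_mul_of_nonneg_left (by linarith) (Nat.cast_nonneg _)
    linarith
  have hVp : ∀ a ∈ A, 2 * (V a).card < p := by
    intro a ha
    have h5 : ((V a).card : ℝ) ≤ 256 * (D : ℝ) ^ 2 := by exact_mod_cast hVc' a ha
    have h6 : (D : ℝ) ^ 2 ≤ L ^ 2 := pow_le_pow_left₀ (by linarith) hDL 2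
    have h7 : (2 * (V a).card : ℝ) < p := by linarith
    exact_mod_cast h7
  -- The number `N ^ (1 - γ)` separates few inert inputs from many.
  set Q : ℝ := (N : ℝ) ^ (1 - γ) with hQ
  have hQ0 : 0 < Q := Real.rpow_pos_of_pos hx0 _
  have hAQ : 4 * Q ≤ A.card * ρ := by
    have h1 : (N : ℝ) ≤ A.card * (1 + 512 * (D : ℝ) ^ 3) * 2 := by
      have h2 : N / 2 ≤ A.card * (1 + 512 * D ^ 3) := by
        refine hAc.trans (Nat.mul_le_mul_left _ (Nat.add_le_add_left ?_ 1))
        calc 8 * D * 2 ^ (J + 1) * (2 * D) ≤ 256 * D ^ 2 * (2 * D) := Nat.mul_le_mul_right _ hB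
          _ = 512 * D ^ 3 := by ring
      have h3 : N ≤ A.card * (1 + 512 * D ^ 3) * 2 := by omega
      exact_mod_cast h3
    have h4 : 8 * (1 + 512 * (D : ℝ) ^ 3) ≤ (N : ℝ) ^ (γ / 2) := by
      have h5 : (D : ℝ) ^ 3 ≤ L ^ 3 := pow_le_pow_left₀ (by linarith) hDL 3
      have h6 : 1 ≤ L ^ 3 := one_le_pow₀ hL1
      linarith
    have h7 : 4 * (N : ℝ) ≤ A.card * (N : ℝ) ^ (γ / 2) := by
      have := mul_le_mul_of_nonneg_left h4 (Nat.cast_nonneg (α := ℝ) A.card)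
      linarith
    have h8 : (N : ℝ) ^ (γ / 2) * (N : ℝ) ^ (-γ) = ρ := by
      rw [hρdef, ← Real.rpow_add hx0]
      congr 1
      ring
    have h9 : (N : ℝ) * (N : ℝ) ^ (-γ) = Q := by
      rw [hQ, sub_eq_add_neg, Real.rpow_add hx0, Real.rpow_one]
    rw [← h8, ← h9, ← mul_assoc, ← mul_assoc]
    exact mul_le_mul_of_nonneg_right h7 (Real.rpow_nonneg hx0.le _)
  have hAne : A.Nonempty := by
    rw [Finset.nonempty_iff_ne_empty]
    rintro rfl
    simp at hAQ
    linarith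
  set lam : ℝ := (N : ℝ) ^ (1 - 2 * γ) with hlamdef
  have hlam : 0 < lam := Real.rpow_pos_of_pos hx0 _
  have hlamN : 20 * lam ≤ N := by
    have h1 : lam * (N : ℝ) ^ (2 * γ) = N := by
      rw [hlamdef, ← Real.rpow_add hx0, sub_add_cancel, Real.rpow_one]
    calc 20 * lam ≤ (N : ℝ) ^ (2 * γ) * lam := mul_le_mul_of_nonneg_right (by linarith) hlam.le
      _ = N := by rw [mul_comm, h1]
  have hlamQ : 9 * L * lam ≤ Q := by
    have h1 : (N : ℝ) ^ γ * lam = Q := by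
      rw [hlamdef, hQ, ← Real.rpow_add hx0]
      congr 1
      ring
    rw [← h1]
    exact mul_le_mul_of_nonneg_right E3 hlam.le
  have hlamL : L ≤ lam ∧ 16 * N * L ^ 2 ≤ lam ^ 2 := by
    have h1 : (N : ℝ) ^ (3 / 4 : ℝ) ≤ lam :=
      Real.rpow_le_rpow_of_exponent_le hx1 (by linarith)
    have h2 : (N : ℝ) ^ (1 / 2 : ℝ) ≤ (N : ℝ) ^ (3 / 4 : ℝ) :=
      Real.rpow_le_rpow_of_exponent_le hx1 (by norm_num)
    refine ⟨by linarith, ?_⟩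
    have h3 : (N : ℝ) * (N : ℝ) ^ (1 / 2 : ℝ) = ((N : ℝ) ^ (3 / 4 : ℝ)) ^ 2 := by
      rw [← Real.rpow_natCast, ← Real.rpow_mul hx0.le]
      nth_rewrite 1 [← Real.rpow_one (N : ℝ)]
      rw [← Real.rpow_add hx0]
      norm_num
    calc 16 * N * L ^ 2 = N * (16 * L ^ 2) := by ring
      _ ≤ N * (N : ℝ) ^ (1 / 2 : ℝ) := mul_le_mul_of_nonneg_left E2 hx0.le
      _ = _ := h3
      _ ≤ lam ^ 2 := pow_le_pow_left₀ (by positivity) h1 2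
  set r : ℝ := Real.exp (-(N : ℝ) ^ (1 / 8 : ℝ)) with hr
  have hpN : (p : ℝ) ≤ c₂ * (N : ℝ) ^ (1 / 3 : ℝ) :=
    hp₂.trans (mul_le_mul_of_nonneg_left
      (Real.rpow_le_rpow_of_exponent_le hx1 hα.le) hc₂.le)
  have hY : ∀ u, N * Real.log 2 <
      Real.log 2 / k * (Finset.univ \ inert f V A u).card + 2 * lam →
      ((inert f V A u).card : ℝ) < A.card * ρ / 4 ∧
      Real.exp (-(bitLaw b true * bitLaw b false / (2 * p ^ 2)) * (A.card * ρ / 4)) ≤ r := by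
    intro u hu
    have hlog2 : 0 < Real.log 2 := Real.log_pos one_lt_two
    have h1 : ((Finset.univ \ inert f V A u).card : ℝ) = ℓ - (inert f V A u).card := by
      rw [Finset.card_sdiff_of_subset (Finset.subset_univ _), Finset.card_univ, Fintype.card_fin,
        Nat.cast_sub ((Finset.card_le_univ _).trans (by simp))]
    have h2 : ((Finset.univ \ inert f V A u).card : ℝ) ≤ 2 * N * L := by
      have h3 : ((Finset.univ \ inert f V A u).card : ℝ) ≤ (Finset.univ.biUnion Wv ∪ Wl).card := by
        exact_mod_cast Finset.card_le_card (compl_inert_subset hxdep hddep hAW u)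
      exact h3.trans (hWc.trans (mul_le_mul_of_nonneg_left hDL (by linarith)))
    obtain ⟨h4, h5⟩ := few_inert_of_information hx0 hL1 hlam hlamN hlamQ (div_pos hlog2 hk)
      (div_mul_cancel₀ _ hk.ne') hℓ h1 h2 hu
    refine ⟨by linarith, Real.exp_le_exp.mpr ?_⟩
    rw [neg_mul, neg_le_neg_iff]
    refine rpow_le_mixing_exponent hx1 hp0 hpN E6 ?_ ?_
    · have h6 := sq_entropy_le_mul hb hent
      have h7 : 1 ≤ (4 * L * (Real.log 2 / k)) ^ 2 := one_le_pow₀ h4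
      have h8 := mul_le_mul_of_nonneg_left h6 (by positivity : (0 : ℝ) ≤ 16 * L ^ 2)
      rw [mul_pow] at h7
      linarith
    · have : (N : ℝ) ^ (7 / 8 : ℝ) ≤ Q := Real.rpow_le_rpow_of_exponent_le hx1 (by linarith)
      linarith
  have hmain := le_tvDistance_of_isolated H hxdep hddep (hS (Fin.last N)) hp2 hN hb hk hent hAW hAne
    hρ hVρ hVp hlam (Real.exp_pos _).le hY
  have hL0 : 0 < L := by linarith
  -- Each of the error terms is at most `1 / log N`.
  have e1 : 1 / (p : ℝ) ≤ 1 / L := one_div_le_one_div_of_le hL0 (by linarith)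
  have e2 : p * r ≤ 1 / L := by
    rw [le_div_iff₀ hL0, hr, Real.exp_neg, mul_assoc, mul_comm _ L, ← mul_assoc, ← div_eq_mul_inv,
      div_le_one (Real.exp_pos _)]
    calc (p : ℝ) * L ≤ c₂ * (N : ℝ) ^ (1 / 3 : ℝ) * L := by gcongr
      _ = c₂ * L * (N : ℝ) ^ (1 / 3 : ℝ) := by ring
      _ ≤ (N : ℝ) ^ (1 / 2 : ℝ) * (N : ℝ) ^ (1 / 3 : ℝ) := by gcongr
      _ ≤ (N : ℝ) ^ (1 : ℝ) := by
          rw [← Real.rpow_add hx0]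
          exact Real.rpow_le_rpow_of_exponent_le hx1 (by norm_num)
      _ = Real.exp L := by rw [Real.rpow_one, hL, Real.exp_log hx0]
      _ ≤ _ := Real.exp_le_exp.mpr E8
  have e3 : ((Finset.univ.biUnion Wv ∪ Wl).card : ℝ) * 8 / lam ^ 2 ≤ 1 / L := by
    rw [div_le_div_iff₀ (by positivity) hL0, one_mul]
    have h1 : ((Finset.univ.biUnion Wv ∪ Wl).card : ℝ) * 8 * L ≤ 2 * N * L * 8 * L := by
      have : 2 * (N : ℝ) * D ≤ 2 * N * L := mul_le_mul_of_nonneg_left hDL (by linarith)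
      gcongr
      linarith
    linarith [hlamL.2]
  have e4 : Real.exp (-lam) ≤ 1 / L := by
    rw [Real.exp_neg, ← one_div]
    exact one_div_le_one_div_of_le hL0 (hlamL.1.trans (by linarith [Real.add_one_le_exp lam]))
  have e5 : 4 / (A.card * ρ) ≤ 1 / L := by
    rw [div_le_div_iff₀ (by linarith) hL0, one_mul]
    have : L * 1 ≤ L * lam := mul_le_mul_of_nonneg_left (hL1.trans hlamL.1) hL0.le
    linarith
  have e6 : 4 / L = 4 * (1 / L) := by ring
  rw [e6]
  linarith

end Parameters

end LocalSampling

theorem mainTheorem8 (δ : ℝ) (hδ : δ < 1) :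
    ∃ ε : ℝ, 0 < ε ∧
      ∀ α : ℝ, 0 < α → δ / 3 < α → α < 1 / 3 →
      ∀ c₁ c₂ : ℝ, 0 < c₁ → 0 < c₂ →
      ∃ (C : ℝ) (N₀ : ℕ), ∀ N : ℕ, N₀ ≤ N → Even N →
      ∀ p : ℕ, p.Prime → c₁ * (N : ℝ) ^ α ≤ p → (p : ℝ) ≤ c₂ * (N : ℝ) ^ α →
      ∀ (b k : ℝ) (hb : |b| ≤ 1 / 2), 0 < k → bitEntropy (biasedBit b hb) = 1 / k →
      ∀ (ℓ : ℕ), (ℓ : ℝ) ≤ k * N + (N : ℝ) ^ δ →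
      ∀ f : (Fin ℓ → Bool) → (Fin (N + 1) → Bool),
        IsLocal ((ε * Real.log N) ^ (1 / 2 : ℝ)) f →
        1 / 2 - C / Real.log N ≤ tvDistance ((biasedBits b hb ℓ).map f) (targetDist p N) := by
  -- The exponent `3 / 4` leaves room for the fluctuations, of order `√N`, of the information in the
  -- input bits.
  set γ : ℝ := (1 - max δ (3 / 4)) / 2 with hγdef
  have hmax : max δ (3 / 4) < 1 := max_lt hδ (by norm_num)
  have hγ0 : 0 < γ := by linarith
  have hγ : γ ≤ 1 / 8 := by linarith [le_max_right δ (3 / 4)]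
  have hexp : 1 - 2 * γ = max δ (3 / 4) := by rw [hγdef]; ring
  -- For this `ε`, extremal patterns have probability at least `N ^ (-γ / 2)`.
  refine ⟨γ / 1024, by positivity, fun α hα0 _ hα c₁ c₂ hc₁ hc₂ => ?_⟩
  have hlog : Filter.Tendsto (fun N : ℕ => Real.log (N : ℝ)) Filter.atTop Filter.atTop :=
    Real.tendsto_log_atTop.comp tendsto_natCast_atTop_atTop
  have hev : ∀ᶠ N : ℕ in Filter.atTop, 1024 / γ ≤ Real.log N ∧ 40 * Real.log N ≤ N ∧
      4104 * Real.log N ^ 3 ≤ (N : ℝ) ^ (γ / 2) ∧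
      16 * Real.log N ^ 2 ≤ (N : ℝ) ^ (1 / 2 : ℝ) ∧ 9 * Real.log N ≤ (N : ℝ) ^ γ ∧
      20 * Real.log N ≤ (N : ℝ) ^ (2 * γ) ∧ 515 * Real.log N ^ 2 < c₁ * (N : ℝ) ^ α ∧
      576 * c₂ ^ 2 * Real.log N ^ 2 ≤ (N : ℝ) ^ (1 / 12 : ℝ) ∧
      c₂ * Real.log N ≤ (N : ℝ) ^ (1 / 2 : ℝ) ∧ Real.log N ≤ (N : ℝ) ^ (1 / 8 : ℝ) := by
    filter_upwards [hlog.eventually_ge_atTop (1024 / γ),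
      LocalSampling.eventually_mul_log_pow_le 40 1 one_pos, LocalSampling.eventually_mul_log_pow_le 4104 3 (half_pos hγ0),
      LocalSampling.eventually_mul_log_pow_le 16 2 (r := 1 / 2) (by norm_num), LocalSampling.eventually_mul_log_pow_le 9 1 hγ0,
      LocalSampling.eventually_mul_log_pow_le 20 1 (r := 2 * γ) (by linarith),
      LocalSampling.eventually_mul_log_pow_le (516 / c₁) 2 hα0,
      LocalSampling.eventually_mul_log_pow_le (576 * c₂ ^ 2) 2 (r := 1 / 12) (by norm_num),
      LocalSampling.eventually_mul_log_pow_le c₂ 1 (r := 1 / 2) (by norm_num),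
      LocalSampling.eventually_mul_log_pow_le 1 1 (r := 1 / 8) (by norm_num)] with N h0 h1 h2 h3 h4 h5 h6 h7 h8 h9
    simp only [pow_one, Real.rpow_one, one_mul] at h1 h4 h5 h8 h9
    refine ⟨h0, h1, h2, h3, h4, h5, ?_, h7, h8, h9⟩
    have hL : 0 < Real.log N := lt_of_lt_of_le (by positivity) h0
    rw [div_mul_eq_mul_div, div_le_iff₀ hc₁] at h6
    linarith [pow_pos hL 2]
  obtain ⟨N₀, hN₀⟩ := Filter.eventually_atTop.mp hev
  refine ⟨4, N₀, fun N hN hNe p hp hp₁ hp₂ b k hb hk hent ℓ hℓ f hf => ?_⟩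
  obtain ⟨h0, h1, h2, h3, h4, h5, h6, h7, h8, h9⟩ := hN₀ N hN
  have hL0 : 0 < Real.log N := lt_of_lt_of_le (by positivity) h0
  rcases lt_or_ge ℓ N with hlt | hge
  · have := LocalSampling.half_le_tvDistance_of_lt hb hlt p f
    have h4L : 0 ≤ 4 / Real.log N := by positivity
    linarith
  rw [div_le_iff₀ hγ0] at h0
  set s : ℝ := (γ / 1024 * Real.log N) ^ (1 / 2 : ℝ) with hs
  have hs2 : s ^ 2 = γ / 1024 * Real.log N := by
    rw [hs, ← Real.rpow_natCast, ← Real.rpow_mul (by positivity)]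
    norm_num
  have hs1 : 1 ≤ s := Real.one_le_rpow (by linarith) (by norm_num)
  have hD1 : 1 ≤ ⌊s⌋₊ := Nat.one_le_floor_iff s |>.mpr hs1
  have hDs : (⌊s⌋₊ : ℝ) ≤ s := Nat.floor_le (by linarith)
  have hx1 : (1 : ℝ) ≤ N := by
    have : N ≠ 0 := by
      rintro rfl
      simp at hL0
    exact_mod_cast Nat.one_le_iff_ne_zero.mpr this
  refine LocalSampling.le_tvDistance_of_large (D := ⌊s⌋₊) hγ0 hγ hα hc₂ hNe hp hp₁ hp₂ hb hk hent hge
    (hℓ.trans ?_) f (fun i => ?_) hD1 ?_ ?_ h1 h2 h3 h4 h5 h6 h7 h8 h9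
  · rw [hexp]
    linarith [Real.rpow_le_rpow_of_exponent_le hx1 (le_max_left δ (3 / 4))]
  · obtain ⟨S, hSc, hS⟩ := hf i
    exact ⟨S, Nat.le_floor hSc, hS⟩
  · have : (⌊s⌋₊ : ℝ) ^ 2 ≤ s ^ 2 := pow_le_pow_left₀ (Nat.cast_nonneg _) hDs 2
    linarith
  · have h10 : s ≤ s ^ 2 := by nlinarith
    have h11 : γ * Real.log N ≤ 1 * Real.log N := by gcongr; linarith
    linarith
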